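/- Let $n\ge 0$ and $p,q\ge 1$ be integers and let $\mathbb{A}=[A_{i,j}]_{1\le i\le p,\,1\le j\le q}$ be a complex block matrix all of whose blocks $A_{i,j}$ are normal $n\times n$ matrices. Let $f:[0,\infty)\to[0,\infty)$ be concave and e-convex, i.e. $t\mapsto f(e^t)$ is convex on $(-\infty,\infty)$. For a matrix $X$ put $|X|=(X^*X)^{1/2}$, and let $f(|X|)$ be defined by functional calculus. Then for every symmetric norm $\|\cdot\|$ on the $qn\times qn$ complex matrices, i.e. every norm with $\|UXV\|=\|X\|$ for all $X$ and all unitaries $U,V$, $$ \bigl\|\,f(|\mathbb{A}|)\,\bigr\|\;\le\;\Bigl\|\,\sum_{i=1}^{p}\sum_{j=1}^{q} f(|A_{i,j}|)\,\Bigr\|, $$ where, as usual, the norm of the $n\times n$ matrix $S=\sum_{i,j} f(|A_{i,j}|)$ on the right means the norm of the $qn\times qn$ matrix $S\oplus 0=\begin{pmatrix}S&0\\0&0\end{pmatrix}$. -/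

import Mathlib

open scoped Matrix MatrixOrder

/-- A symmetric (unitarily invariant) norm on the square complex matrices indexed by `ι`: a norm
`N` on the complex vector space of matrices with `N (U * X * V) = N X` for all unitary `U`, `V`. -/
structure SymmetricNorm (ι : Type*) [Fintype ι] [DecidableEq ι] extends
    Seminorm ℂ (Matrix ι ι ℂ) where
  eq_zero_of_map_eq_zero : ∀ X : Matrix ι ι ℂ, toFun X = 0 → X = 0
  unitarily_invariant : ∀ U ∈ Matrix.unitaryGroup ι ℂ, ∀ V ∈ Matrix.unitaryGroup ι ℂ,
    ∀ X : Matrix ι ι ℂ, toFun (U * X * V) = toFun X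

/-- The absolute value `|X| = (Xᴴ X)^{1/2}` of a possibly rectangular complex matrix. For a square
matrix this is `CFC.abs X`. -/
noncomputable def matrixAbs {ι κ : Type*} [Fintype ι] [Fintype κ] [DecidableEq κ]
    (X : Matrix ι κ ℂ) : Matrix κ κ ℂ :=
  CFC.sqrt (Xᴴ * X)

/-- `f(|X|)`, by the functional calculus of the Hermitian matrix `|X|`. -/
noncomputable def funAbs {ι κ : Type*} [Fintype ι] [Fintype κ] [DecidableEq κ]
    (f : ℝ → ℝ) (X : Matrix ι κ ℂ) : Matrix κ κ ℂ :=
  cfc f (matrixAbs X)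

/-- The matrix with `q × q` blocks of size `n × n` whose upper left block is `X` and whose other
blocks vanish, that is `X ⊕ 0`. -/
def zeroPad {n : ℕ} (q : ℕ) [NeZero q] (X : Matrix (Fin n) (Fin n) ℂ) :
    Matrix (Fin q × Fin n) (Fin q × Fin n) ℂ :=
  Matrix.comp (Fin q) (Fin q) (Fin n) (Fin n) ℂ (Matrix.single 0 0 X)

/-- `f` is e-convex: `t ↦ f (e ^ t)` is convex on the whole real line. -/
def EConvex (f : ℝ → ℝ) : Prop :=
  ConvexOn ℝ Set.univ (fun t => f (Real.exp t))

/-! By Fan dominance it suffices to compare thresholded traces: for every `c ≥ 0`, `Tr (f(|𝔸|) - c)₊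
≤ Tr (S - c)₊` with `S = ∑ f(|A i j|)`; the zeros padding `S` add nothing. Suppose first `c ≥ f 0`,
so that `g = (f - c)₊` is nondecreasing, e-convex and zero at `0`.

Normality makes each `[[|A i j|, A i jᴴ], [A i j, |A i j|]]` positive. Placing these in their blocks
and summing gives a positive matrix `[[C, 𝔸ᴴ], [𝔸, R]]`, where `C` and `R` are block diagonal with
blocks `∑ i, |A i j|` (columns) and `∑ j, |A i j|` (rows). Compressing to singular vectors and
taking a Schur complement, the products of the largest squared singular values of `𝔸` are at most
those of `λ_l(C) λ_l(R)` (`prod_eigenvalues_le`). Karamata's inequality for `g ∘ exp` and midpoint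
convexity then give `Tr g(|𝔸|) ≤ (Tr g(C) + Tr g(R)) / 2` (`sum_map_sqrt_eigenvalues_le`).

Concavity bounds both `Tr g(C)` and `Tr g(R)` by `Tr (S - c)₊` (`sum_threshold_le_threshold_sum`). A
truncation of `f` in Rotfel'd's inequality gives subadditivity on the spectral subspace `f > c` of
each block. The span of these subspaces has dimension at most the sum of their dimensions, so
testing `S - c` on it finishes the bound.

For `c < f 0` the left threshold is inactive, and the case of `f - f 0` at level `0` suffices. -/

/-! ### Majorization of real sequences, convex and concave functions. -/

section Real

/-- **Abel summation**: an antitone non-negative weight preserves non-negativity of partial sums. -/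
theorem sum_mul_nonneg_of_partial_sums {a d : ℕ → ℝ} (n : ℕ)
    (ha : ∀ i j, i ≤ j → j < n → a j ≤ a i) (ha0 : ∀ i < n, 0 ≤ a i)
    (hd : ∀ k ≤ n, 0 ≤ ∑ i ∈ Finset.range k, d i) :
    0 ≤ ∑ i ∈ Finset.range n, a i * d i := by
  -- The induction needs a sharper bound, keeping the last weight times the partial sum.
  have key : ∀ k, k + 1 ≤ n →
      a k * ∑ i ∈ Finset.range (k + 1), d i ≤ ∑ i ∈ Finset.range (k + 1), a i * d i := by
    intro k
    induction k with
    | zero => intro _; simp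
    | succ k ih =>
      intro hk
      rw [Finset.sum_range_succ _ (k + 1), Finset.sum_range_succ _ (k + 1), mul_add]
      have h1 := ih (by omega)
      have h2 := mul_le_mul_of_nonneg_right (ha k (k + 1) (by omega) (by omega))
        (hd (k + 1) (by omega))
      linarith
  cases n with
  | zero => simp
  | succ n => exact (mul_nonneg (ha0 n (by omega)) (hd _ le_rfl)).trans (key n le_rfl)

/-- A finite family of reals can be enumerated in decreasing order. -/
theorem exists_equiv_antitone {ι : Type*} [Fintype ι] (β : ι → ℝ) :
    ∃ e : Fin (Fintype.card ι) ≃ ι, Antitone (β ∘ e) := by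
  let e₀ := (Fintype.equivFin ι).symm
  let s := Tuple.sort (fun i => -β (e₀ i))
  refine ⟨s.trans e₀, fun i j hij => ?_⟩
  have := Tuple.monotone_sort (fun i => -β (e₀ i)) hij
  simpa [s] using this

/-- Extension of a finite sequence by zero. -/
def extendZero {m : ℕ} (y : Fin m → ℝ) (l : ℕ) : ℝ := if h : l < m then y ⟨l, h⟩ else 0

theorem extendZero_of_lt {m : ℕ} (y : Fin m → ℝ) {l : ℕ} (h : l < m) :
    extendZero y l = y ⟨l, h⟩ := dif_pos h

theorem extendZero_nonneg {m : ℕ} {y : Fin m → ℝ} (hy : ∀ i, 0 ≤ y i) (l : ℕ) :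
    0 ≤ extendZero y l := by
  unfold extendZero; split_ifs <;> simp [hy]

theorem extendZero_antitone {m : ℕ} {y : Fin m → ℝ} (hy : ∀ i, 0 ≤ y i) (ha : Antitone y) :
    Antitone (extendZero y) := by
  intro i j hij
  by_cases hj : j < m
  · rw [extendZero_of_lt y hj, extendZero_of_lt y (hij.trans_lt hj)]
    exact ha hij
  · rw [extendZero, dif_neg hj]
    exact extendZero_nonneg hy i

theorem sum_extendZero {m : ℕ} (φ : ℝ → ℝ) (y : Fin m → ℝ) :
    ∑ l ∈ Finset.range m, φ (extendZero y l) = ∑ i, φ (y i) := by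
  rw [Finset.sum_range]
  exact Finset.sum_congr rfl fun i _ => by rw [extendZero_of_lt y i.2]

/-- The level `c = y k` is sharp: as `y` is antitone, its thresholded sum is exactly `∑ i < k, (y i
- y k)`, while for `x`, in any order, it only exceeds the corresponding sum. -/
theorem sum_range_le_of_threshold {x y : ℕ → ℝ} {m : ℕ} (hy : Antitone y) (hy0 : ∀ i, 0 ≤ y i)
    (hc : ∀ c, 0 ≤ c → ∑ i ∈ Finset.range m, max (x i - c) 0 ≤
      ∑ i ∈ Finset.range m, max (y i - c) 0) {k : ℕ} (hk : k ≤ m) :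
    ∑ i ∈ Finset.range k, x i ≤ ∑ i ∈ Finset.range k, y i := by
  have hsub : Finset.range k ⊆ Finset.range m := Finset.range_subset_range.2 hk
  have h1 : ∑ i ∈ Finset.range k, (x i - y k) ≤ ∑ i ∈ Finset.range m, max (x i - y k) 0 :=
    (Finset.sum_le_sum fun i _ => le_max_left _ _).trans
      (Finset.sum_le_sum_of_subset_of_nonneg hsub fun i _ _ => le_max_right _ _)
  have h2 : ∑ i ∈ Finset.range m, max (y i - y k) 0 = ∑ i ∈ Finset.range k, (y i - y k) := by
    rw [← Finset.sum_subset hsub (f := fun i => max (y i - y k) 0)]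
    · refine Finset.sum_congr rfl fun i hi => max_eq_left ?_
      have := hy (Finset.mem_range.1 hi).le
      linarith
    · intro i _ hi
      refine max_eq_right ?_
      have := hy (not_lt.1 fun h => hi (Finset.mem_range.2 h))
      linarith
  have h3 := (h1.trans (hc _ (hy0 k))).trans_eq h2
  simp only [Finset.sum_sub_distrib] at h3
  linarith

theorem sum_mul_le_of_threshold {m : ℕ} {a x y : Fin m → ℝ} (ha : Antitone a) (ha0 : ∀ i, 0 ≤ a i)
    (hy : Antitone y) (hy0 : ∀ i, 0 ≤ y i)
    (hc : ∀ c, 0 ≤ c → ∑ i, max (x i - c) 0 ≤ ∑ i, max (y i - c) 0) :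
    ∑ i, a i * x i ≤ ∑ i, a i * y i := by
  have h := sum_mul_nonneg_of_partial_sums (a := extendZero a)
    (d := fun l => extendZero y l - extendZero x l) m
    (fun i j hij _ => extendZero_antitone ha0 ha hij) (fun i _ => extendZero_nonneg ha0 i)
    (fun k hk => by
      rw [Finset.sum_sub_distrib, sub_nonneg]
      refine sum_range_le_of_threshold (extendZero_antitone hy0 hy) (extendZero_nonneg hy0)
        (fun c hc0 => ?_) hk
      rw [sum_extendZero (fun t => max (t - c) 0), sum_extendZero (fun t => max (t - c) 0)]
      exact hc c hc0)
  rw [Finset.sum_range] at h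
  simp only [extendZero_of_lt _ (Fin.is_lt _), Fin.eta, mul_sub, Finset.sum_sub_distrib] at h
  linarith

/-- A convex function on the line has a monotone selection of subgradients. -/
theorem ConvexOn.exists_monotone_subgradient {G : ℝ → ℝ} (hG : ConvexOn ℝ Set.univ G) :
    ∃ s : ℝ → ℝ, Monotone s ∧ ∀ x y, G x + s x * (y - x) ≤ G y := by
  refine ⟨fun x => derivWithin G (Set.Ioi x) x, fun x y hxy => ?_, fun x y => ?_⟩
  · exact hG.monotoneOn_rightDeriv (by simp) (by simp) hxy
  · rcases lt_trichotomy x y with h | rfl | h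
    · have := hG.rightDeriv_le_slope_of_mem_interior (x := x) (y := y) (by simp) (by simp) h
      rw [slope_def_field, le_div_iff₀ (by linarith)] at this
      linarith
    · simp
    · have h1 := hG.slope_le_leftDeriv_of_mem_interior (x := y) (y := x) (by simp) (by simp) h
      have h2 := h1.trans (hG.leftDeriv_le_rightDeriv_of_mem_interior (x := x) (by simp))
      rw [slope_def_field, div_le_iff₀ (by linarith)] at h2
      linarith

/-- **Karamata's inequality** for weak majorization and a monotone convex function. -/
theorem ConvexOn.sum_le_sum_of_weak_majorization {G : ℝ → ℝ} (hG : ConvexOn ℝ Set.univ G)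
    (hmono : Monotone G) {x y : ℕ → ℝ} {n : ℕ} (hx : ∀ i j, i ≤ j → j < n → x j ≤ x i)
    (hxy : ∀ k ≤ n, ∑ i ∈ Finset.range k, x i ≤ ∑ i ∈ Finset.range k, y i) :
    ∑ i ∈ Finset.range n, G (x i) ≤ ∑ i ∈ Finset.range n, G (y i) := by
  obtain ⟨s, hs, hsub⟩ := hG.exists_monotone_subgradient
  -- Monotonicity of `G` makes the subgradients non-negative; this is why weak majorization
  -- suffices. They serve as Abel weights, antitone along the sorted `x`.
  have hs0 : ∀ t, 0 ≤ s t := fun t => by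
    have h1 := hsub t (t - 1)
    have h2 := hmono (show t - 1 ≤ t by linarith)
    linarith
  have h := sum_mul_nonneg_of_partial_sums (a := fun i => s (x i)) (d := fun i => y i - x i) n
    (fun i j hij hj => hs (hx i j hij hj)) (fun i _ => hs0 _)
    (fun k hk => by rw [Finset.sum_sub_distrib, sub_nonneg]; exact hxy k hk)
  have h2 : ∑ i ∈ Finset.range n, (G (x i) + s (x i) * (y i - x i)) ≤
      ∑ i ∈ Finset.range n, G (y i) := Finset.sum_le_sum fun i _ => hsub _ _
  rw [Finset.sum_add_distrib] at h2
  linarith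

/-- A non-negative concave function on `[0, ∞)` is nondecreasing. -/
theorem ConcaveOn.monotoneOn_of_nonneg {f : ℝ → ℝ} (hf : ConcaveOn ℝ (Set.Ici 0) f)
    (h0 : ∀ t, 0 ≤ t → 0 ≤ f t) : MonotoneOn f (Set.Ici 0) := by
  intro x hx y hy hxy
  by_contra! h
  have hlt : x < y := lt_of_le_of_ne hxy fun he => by rw [he] at h; exact lt_irrefl _ h
  have hδ : 0 < (f x - f y) / (y - x) := div_pos (by linarith) (by linarith)
  set δ := (f x - f y) / (y - x) with hδ_def
  -- The line through `(y, f y)` of slope `-δ` takes the value `-1` at `z`, and concavity keeps `f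
  -- z` below it.
  set z := y + (f y + 1) / δ with hz
  have hfy := h0 y hy
  have hyz : y < z := by have : 0 < (f y + 1) / δ := by positivity
                         linarith
  have h1 := hf.slope_anti_adjacent hx (Set.mem_Ici.2 ((Set.mem_Ici.1 hy).trans hyz.le)) hlt hyz
  have h2 : (f y - f x) / (y - x) = -δ := by rw [hδ_def]; ring
  rw [h2, div_le_iff₀ (by linarith)] at h1
  have h3 : δ * (z - y) = f y + 1 := by rw [hz]; field_simp; ring
  have h4 := h0 z ((Set.mem_Ici.1 hy).trans hyz.le)
  linarith

/-- Jensen's inequality with weights of total mass at most one. -/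
theorem ConcaveOn.sum_le_map_sum_of_weights_le_one {f : ℝ → ℝ} (hf : ConcaveOn ℝ (Set.Ici 0) f)
    (h0 : 0 ≤ f 0) {ι : Type*} (s : Finset ι) {p x : ι → ℝ} (hp : ∀ i ∈ s, 0 ≤ p i)
    (hp1 : ∑ i ∈ s, p i ≤ 1) (hx : ∀ i ∈ s, 0 ≤ x i) :
    ∑ i ∈ s, p i * f (x i) ≤ f (∑ i ∈ s, p i * x i) := by
  -- The missing mass is placed at the point `0`, where `f` is non-negative.
  have h := hf.le_map_sum (t := Finset.insertNone s)
    (w := fun o => o.elim (1 - ∑ i ∈ s, p i) p) (p := fun o => o.elim 0 x)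
    (by
      intro o ho
      cases o with
      | none => simpa using hp1
      | some i => exact hp i (by simpa using ho))
    (by simp [Finset.sum_insertNone])
    (by
      intro o ho
      cases o with
      | none => simp
      | some i => exact hx i (by simpa using ho))
  simp only [Finset.sum_insertNone, Option.elim, smul_eq_mul, mul_zero, zero_add] at h
  have h2 := mul_nonneg (sub_nonneg.2 hp1) h0
  linarith

end Real

/-! ### Fan dominance for symmetric norms. -/

section Fan

variable {ι : Type*} [Fintype ι] [DecidableEq ι]

/-- The complex diagonal matrix with real entries `x`. -/
noncomputable def realDiagonal (x : ι → ℝ) : Matrix ι ι ℂ := Matrix.diagonal fun i => (x i : ℂ)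

theorem toMatrix_toPEquiv_mem_unitaryGroup (π : Equiv.Perm ι) :
    (π.toPEquiv.toMatrix : Matrix ι ι ℂ) ∈ Matrix.unitaryGroup ι ℂ := by
  rw [Matrix.mem_unitaryGroup_iff]
  ext i j
  rw [PEquiv.toMatrix_toPEquiv_mul]
  simp only [Matrix.submatrix_apply, Matrix.star_apply, id, PEquiv.toMatrix_apply, Matrix.one_apply,
    Equiv.toPEquiv_apply, Option.mem_def, Option.some.injEq]
  by_cases h : i = j
  · simp [h]
  · simp [h, Ne.symm h]

theorem SymmetricNorm.realDiagonal_comp_perm (N : SymmetricNorm ι) (y : ι → ℝ)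
    (π : Equiv.Perm ι) :
    N.toSeminorm (realDiagonal (y ∘ π)) = N.toSeminorm (realDiagonal y) := by
  have h := N.unitarily_invariant _ (toMatrix_toPEquiv_mem_unitaryGroup π) _
    (toMatrix_toPEquiv_mem_unitaryGroup π.symm) (realDiagonal y)
  rw [PEquiv.toMatrix_toPEquiv_mul, PEquiv.mul_toMatrix_toPEquiv] at h
  have h2 : ((realDiagonal y).submatrix π id).submatrix id π.symm.symm =
      realDiagonal (y ∘ π) := by
    ext i j
    simp [realDiagonal, Matrix.diagonal_apply]
  rw [h2] at h
  exact h

theorem SymmetricNorm.realDiagonal_sign_mul (N : SymmetricNorm ι) (y : ι → ℝ) (ε : ι → ℤˣ) :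
    N.toSeminorm (realDiagonal fun i => ((ε i : ℤ) : ℝ) * y i) =
      N.toSeminorm (realDiagonal y) := by
  have hU : (Matrix.diagonal fun i => ((ε i : ℤ) : ℂ)) ∈ Matrix.unitaryGroup ι ℂ := by
    rw [Matrix.mem_unitaryGroup_iff, Matrix.star_eq_conjTranspose, Matrix.diagonal_conjTranspose,
      Matrix.diagonal_mul_diagonal, ← Matrix.diagonal_one]
    congr 1
    funext i
    rcases Int.units_eq_one_or (ε i) with h | h <;> simp [h]
  have h := N.unitarily_invariant _ hU 1 (one_mem _) (realDiagonal y)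
  rw [mul_one, realDiagonal, Matrix.diagonal_mul_diagonal] at h
  rw [realDiagonal]
  simp only [Complex.ofReal_mul, Complex.ofReal_intCast]
  exact h

theorem SymmetricNorm.convex_sublevel (N : SymmetricNorm ι) (r : ℝ) :
    Convex ℝ {z : ι → ℝ | N.toSeminorm (realDiagonal z) ≤ r} := by
  intro z hz w hw a b ha hb hab
  have h : realDiagonal (a • z + b • w) =
      (a : ℂ) • realDiagonal z + (b : ℂ) • realDiagonal w := by
    ext i j
    by_cases hij : i = j <;> simp [realDiagonal, hij]
  simp only [Set.mem_ofPred_eq] at hz hw ⊢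
  rw [h]
  refine (map_add_le_add _ _ _).trans ?_
  rw [map_smul_eq_mul, map_smul_eq_mul, Complex.norm_real, Complex.norm_real,
    Real.norm_of_nonneg ha, Real.norm_of_nonneg hb]
  have h1 := mul_le_mul_of_nonneg_left hz ha
  have h2 := mul_le_mul_of_nonneg_left hw hb
  have h3 : a * r + b * r = r := by rw [← add_mul, hab, one_mul]
  linarith

/-- A vector that is weakly majorized by `y ≥ 0` is a convex combination of the vectors obtained
from `y` by permutations and changes of sign. -/
theorem mem_convexHull_signed_perm {x y : ι → ℝ} (hx : ∀ i, 0 ≤ x i) (hy : ∀ i, 0 ≤ y i)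
    (hc : ∀ c, 0 ≤ c → ∑ i, max (x i - c) 0 ≤ ∑ i, max (y i - c) 0) :
    x ∈ convexHull ℝ (Set.range fun p : (ι → ℤˣ) × Equiv.Perm ι =>
      fun i => ((p.1 i : ℤ) : ℝ) * y (p.2 i)) := by
  by_contra hnot
  obtain ⟨F, u, hF, hu⟩ := geometric_hahn_banach_closed_point (convex_convexHull ℝ _)
    ((Set.finite_range _).isClosed_convexHull (𝕜 := ℝ)) hnot
  set w : ι → ℝ := fun i => F (Pi.single i 1) with hw
  have hFw : ∀ z : ι → ℝ, F z = ∑ i, w i * z i := by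
    intro z
    conv_lhs => rw [pi_eq_sum_univ' z, map_sum]
    refine Finset.sum_congr rfl fun i _ => ?_
    rw [map_smul, smul_eq_mul, mul_comm, hw]
  -- Among signed permutations of `y`, the separating functional `w` is largest when `y` is sorted
  -- like `|w|` and carries the signs of `w`. That value already dominates `F x`, contradicting
  -- separation.
  obtain ⟨e₁, he₁⟩ := exists_equiv_antitone fun i => |w i|
  obtain ⟨e₂, he₂⟩ := exists_equiv_antitone y
  let ε : ι → ℤˣ := fun i => if 0 ≤ w i then 1 else -1
  have hε : ∀ i, w i * ((ε i : ℤ) : ℝ) = |w i| := by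
    intro i
    by_cases h : 0 ≤ w i
    · simp [ε, h, abs_of_nonneg h]
    · simp [ε, h, abs_of_neg (not_le.1 h)]
  have h1 := (hF _ (subset_convexHull ℝ _ ⟨(ε, e₁.symm.trans e₂), rfl⟩)).trans hu
  rw [hFw, hFw] at h1
  refine absurd h1 (not_lt.2 ?_)
  calc ∑ i, w i * x i ≤ ∑ i, |w i| * x i :=
        Finset.sum_le_sum fun i _ => mul_le_mul_of_nonneg_right (le_abs_self _) (hx i)
    _ = ∑ l, |w (e₁ l)| * x (e₁ l) := (Equiv.sum_comp e₁ fun i => |w i| * x i).symm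
    _ ≤ ∑ l, |w (e₁ l)| * y (e₂ l) := by
        refine sum_mul_le_of_threshold he₁ (fun _ => abs_nonneg _) he₂ (fun _ => hy _) ?_
        intro c hc0
        rw [Equiv.sum_comp e₁ fun i => max (x i - c) 0,
          Equiv.sum_comp e₂ fun i => max (y i - c) 0]
        exact hc c hc0
    _ = ∑ i, |w i| * y (e₂ (e₁.symm i)) := by
        rw [← Equiv.sum_comp e₁ fun i => |w i| * y (e₂ (e₁.symm i))]
        simp
    _ = _ := Finset.sum_congr rfl fun i _ => by
        rw [← hε, mul_assoc]; rfl

/-- **Fan dominance** for diagonal matrices. -/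
theorem SymmetricNorm.realDiagonal_le (N : SymmetricNorm ι) {x y : ι → ℝ} (hx : ∀ i, 0 ≤ x i)
    (hy : ∀ i, 0 ≤ y i)
    (hc : ∀ c, 0 ≤ c → ∑ i, max (x i - c) 0 ≤ ∑ i, max (y i - c) 0) :
    N.toSeminorm (realDiagonal x) ≤ N.toSeminorm (realDiagonal y) := by
  refine convexHull_min ?_ (N.convex_sublevel (N.toSeminorm (realDiagonal y)))
    (mem_convexHull_signed_perm hx hy hc)
  rintro _ ⟨⟨ε, π⟩, rfl⟩
  exact ((N.realDiagonal_sign_mul (y ∘ π) ε).trans (N.realDiagonal_comp_perm y π)).le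

/-- The norm of a Hermitian matrix in terms of its eigenvalues. -/
theorem SymmetricNorm.cfc_eq_realDiagonal (N : SymmetricNorm ι) {A : Matrix ι ι ℂ}
    (hA : A.IsHermitian) (f : ℝ → ℝ) :
    N.toSeminorm (cfc f A) = N.toSeminorm (realDiagonal (f ∘ hA.eigenvalues)) := by
  rw [hA.cfc_eq, Matrix.IsHermitian.cfc, Unitary.conjStarAlgAut_apply]
  exact N.unitarily_invariant _ hA.eigenvectorUnitary.2 _ (Unitary.star_mem hA.eigenvectorUnitary.2) _

end Fan

/-! ### Trace inequalities for positive quadratic forms. -/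

section SpecForm

variable {E : Type*} [NormedAddCommGroup E] [InnerProductSpace ℂ E]
variable {ι κ I J : Type*} [Fintype ι] [Fintype κ] [Fintype I] [Fintype J]

/-- The quadratic form with eigenbasis `b` and eigenvalues `β`. -/
noncomputable def specForm (b : OrthonormalBasis ι ℂ E) (β : ι → ℝ) (x : E) : ℝ :=
  ∑ a, β a * ‖inner ℂ (b a) x‖ ^ 2

theorem specForm_nonneg (b : OrthonormalBasis ι ℂ E) {β : ι → ℝ} (hβ : ∀ a, 0 ≤ β a) (x : E) :
    0 ≤ specForm b β x :=
  Finset.sum_nonneg fun a _ => mul_nonneg (hβ a) (sq_nonneg _)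

theorem specForm_apply_self (b : OrthonormalBasis ι ℂ E) (β : ι → ℝ) (a : ι) :
    specForm b β (b a) = β a := by
  classical
  rw [specForm, Finset.sum_eq_single a]
  · simp
  · intro i _ hi
    simp [b.inner_eq_zero hi]
  · simp

theorem specForm_mono (b : OrthonormalBasis ι ℂ E) {β γ : ι → ℝ} (h : ∀ a, β a ≤ γ a) (x : E) :
    specForm b β x ≤ specForm b γ x :=
  Finset.sum_le_sum fun a _ => mul_le_mul_of_nonneg_right (h a) (sq_nonneg _)

theorem specForm_const_mul (b : OrthonormalBasis ι ℂ E) (r : ℝ) (β : ι → ℝ) (x : E) :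
    specForm b (fun a => r * β a) x = r * specForm b β x := by
  simp only [specForm, Finset.mul_sum, mul_assoc]

theorem sum_specForm_basis (b : OrthonormalBasis ι ℂ E) (v : OrthonormalBasis κ ℂ E) (β : ι → ℝ) :
    ∑ k, specForm b β (v k) = ∑ a, β a := by
  simp only [specForm]
  rw [Finset.sum_comm]
  refine Finset.sum_congr rfl fun a _ => ?_
  rw [← Finset.mul_sum, v.sum_sq_norm_inner_left]
  simp

/-- The trace of `B - c` over an orthonormal family weights each `β a - c` by `∑ k, |⟨b a, w k⟩|²`,
which lies in `[0, 1]` by Bessel. -/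
theorem sum_specForm_sub_le (b : OrthonormalBasis ι ℂ E) (β : ι → ℝ) {w : κ → E}
    (hw : Orthonormal ℂ w) (c : ℝ) :
    ∑ k, (specForm b β (w k) - c) ≤ ∑ a, max (β a - c) 0 := by
  have h1 : ∀ k, specForm b β (w k) - c = ∑ a, (β a - c) * ‖inner ℂ (b a) (w k)‖ ^ 2 := by
    intro k
    simp only [sub_mul, Finset.sum_sub_distrib, ← Finset.mul_sum, b.sum_sq_norm_inner_right,
      hw.1 k]
    simp [specForm]
  simp only [h1]
  rw [Finset.sum_comm]
  refine Finset.sum_le_sum fun a _ => ?_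
  rw [← Finset.mul_sum]
  have h2 : ∑ k, ‖inner ℂ (b a) (w k)‖ ^ 2 ≤ 1 := by
    have := hw.sum_inner_products_le (b a) (s := Finset.univ)
    simpa [norm_inner_symm] using this
  have h3 : 0 ≤ ∑ k, ‖inner ℂ (b a) (w k)‖ ^ 2 := Finset.sum_nonneg fun _ _ => sq_nonneg _
  calc _ ≤ max (β a - c) 0 * ∑ k, ‖inner ℂ (b a) (w k)‖ ^ 2 :=
        mul_le_mul_of_nonneg_right (le_max_left _ _) h3
    _ ≤ max (β a - c) 0 * 1 := mul_le_mul_of_nonneg_left h2 (le_max_right _ _)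
    _ = _ := mul_one _

/-- For each `b a`, Bessel for its projection onto `W` bounds the left side; for the full basis `z`
Parseval gives equality. -/
theorem sum_specForm_le_of_mem (b : OrthonormalBasis ι ℂ E) {β : ι → ℝ} (hβ : ∀ a, 0 ≤ β a)
    (W : Submodule ℂ E) [FiniteDimensional ℂ W] {η : Type*} [Fintype η]
    (z : OrthonormalBasis η ℂ W) {θ : Type*} {w : θ → E}
    (hw : Orthonormal ℂ w) (s : Finset θ)
    (hs : ∀ k ∈ s, w k ∈ W) :
    ∑ k ∈ s, specForm b β (w k) ≤ ∑ i, specForm b β (z i : E) := by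
  simp only [specForm]
  rw [Finset.sum_comm, Finset.sum_comm (s := Finset.univ (α := η))]
  refine Finset.sum_le_sum fun a _ => ?_
  rw [← Finset.mul_sum, ← Finset.mul_sum]
  refine mul_le_mul_of_nonneg_left ?_ (hβ a)
  set u := W.orthogonalProjectionOnto (b a) with hu
  have h1 : ∀ y : W, ‖inner ℂ (b a) (y : E)‖ = ‖inner ℂ (y : E) (u : E)‖ := by
    intro y
    rw [norm_inner_symm, hu, ← Submodule.inner_orthogonalProjectionOnto_eq_of_mem_left,
      Submodule.coe_inner]
  have h2 : ∑ i, ‖inner ℂ (b a) (z i : E)‖ ^ 2 = ‖u‖ ^ 2 := by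
    rw [← z.sum_sq_norm_inner_right u]
    exact Finset.sum_congr rfl fun i _ => by rw [h1, Submodule.coe_inner]
  rw [h2]
  have h3 := hw.sum_inner_products_le (u : E) (s := s)
  refine (Finset.sum_le_sum fun k hk => ?_).trans h3
  exact (congrArg (· ^ 2) (h1 ⟨w k, hs k hk⟩)).le

/-- Sums over orthonormal families taken separately for each form are dominated by the thresholded
trace of the sum of the forms. -/
theorem sum_sum_specForm_sub_le [FiniteDimensional ℂ E]
    (b : I → J → OrthonormalBasis ι ℂ E) {β : I → J → ι → ℝ} (hβ : ∀ i j a, 0 ≤ β i j a)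
    {θ : Type*} {w : I → θ → E} (hw : ∀ i, Orthonormal ℂ (w i)) (s : I → Finset θ)
    (d : OrthonormalBasis ι ℂ E) (δ : ι → ℝ)
    (hsum : ∀ x, specForm d δ x = ∑ i, ∑ j, specForm (b i j) (β i j) x) {c : ℝ} (hc : 0 ≤ c) :
    ∑ i, ∑ a ∈ s i, (∑ j, specForm (b i j) (β i j) (w i a) - c) ≤ ∑ a, max (δ a - c) 0 := by
  classical
  set T : Finset E := Finset.univ.biUnion fun i => (s i).image (w i) with hT
  -- The families for different `i` need not be mutually orthogonal. On their joint span `W` each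
  -- positive form has at least its partial trace, and since `c ≥ 0` the bound `dim W ≤ ∑ card` only
  -- lowers the cost.
  set W : Submodule ℂ E := Submodule.span ℂ (T : Set E) with hW
  have hmem : ∀ i, ∀ a ∈ s i, w i a ∈ W := fun i a ha =>
    Submodule.subset_span (by
      rw [hT, Finset.mem_coe, Finset.mem_biUnion]
      exact ⟨i, Finset.mem_univ _, Finset.mem_image_of_mem _ ha⟩)
  have hcard : Module.finrank ℂ W ≤ ∑ i, (s i).card :=
    (finrank_span_finset_le_card T).trans
      (Finset.card_biUnion_le.trans (Finset.sum_le_sum fun i _ => Finset.card_image_le))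
  set z := stdOrthonormalBasis ℂ W with hz
  have hzo : Orthonormal ℂ fun k => (z k : E) := z.orthonormal.comp_linearIsometry W.subtypeₗᵢ
  refine le_trans ?_ (sum_specForm_sub_le d δ hzo c)
  simp only [Finset.sum_sub_distrib, hsum, Finset.sum_const, nsmul_eq_mul, Finset.card_univ,
    Fintype.card_fin]
  refine sub_le_sub ?_ ?_
  · rw [Finset.sum_comm (s := Finset.univ (α := Fin _))]
    refine Finset.sum_le_sum fun i _ => ?_
    rw [Finset.sum_comm, Finset.sum_comm (s := Finset.univ (α := Fin _))]
    exact Finset.sum_le_sum fun j _ =>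
      sum_specForm_le_of_mem (b i j) (hβ i j) W z (hw i) (s i) (hmem i)
  · rw [← Finset.sum_mul]
    refine mul_le_mul_of_nonneg_right ?_ hc
    exact_mod_cast hcard

/-- **Rotfel'd's trace inequality**. -/
theorem sum_map_le_sum_map_of_specForm_sum (v : OrthonormalBasis ι ℂ E) {μ : ι → ℝ}
    (b : J → OrthonormalBasis κ ℂ E) {β : J → κ → ℝ} (hβ : ∀ j a, 0 ≤ β j a)
    (hsum : ∀ x, specForm v μ x = ∑ j, specForm (b j) (β j) x) {f : ℝ → ℝ}
    (hf : ConcaveOn ℝ (Set.Ici 0) f) (hf0 : f 0 = 0) :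
    ∑ a, f (μ a) ≤ ∑ j, ∑ k, f (β j k) := by
  classical
  have hμ_eq : ∀ a, μ a = ∑ j, specForm (b j) (β j) (v a) := fun a => by
    rw [← hsum, specForm_apply_self]
  have hμ : ∀ a, 0 ≤ μ a := fun a => by
    rw [hμ_eq]; exact Finset.sum_nonneg fun j _ => specForm_nonneg _ (hβ j) _
  set r : J → κ → ι → ℝ := fun j k a => ‖inner ℂ (v a) (b j k)‖ ^ 2 with hr
  have hr0 : ∀ j k a, 0 ≤ r j k a := fun j k a => sq_nonneg _
  have hr_form : ∀ j a, specForm (b j) (β j) (v a) = ∑ k, β j k * r j k a := fun j a => by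
    simp only [specForm, hr, norm_inner_symm]
  have hzero : ∀ j k a, μ a = 0 → β j k * r j k a = 0 := by
    intro j k a ha
    have h1 := hμ_eq a
    rw [ha] at h1
    have h2 := (Finset.sum_eq_zero_iff_of_nonneg
      (fun j _ => specForm_nonneg (b j) (hβ j) (v a))).1 h1.symm j (Finset.mem_univ _)
    rw [hr_form] at h2
    exact (Finset.sum_eq_zero_iff_of_nonneg
      (fun k _ => mul_nonneg (hβ j k) (hr0 j k a))).1 h2 k (Finset.mem_univ _)
  have hmass : ∀ j k, ∑ a, r j k a = 1 := fun j k => by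
    rw [hr, v.sum_sq_norm_inner_right]; simp
  -- With `M` the summed form and `b = b j k`, this is `β ⟨b, M⁻¹ b⟩ ≤ 1`, a consequence of `β b bᴴ
  -- ≤ M`. The convention `0⁻¹ = 0` makes `M⁻¹` a pseudo-inverse.
  have hp1 : ∀ j k, ∑ a, β j k * r j k a / μ a ≤ 1 := by
    intro j k
    set t := ∑ a, r j k a / μ a with ht
    have ht0 : 0 ≤ t := Finset.sum_nonneg fun a _ => div_nonneg (hr0 _ _ _) (hμ a)
    have hβt : ∑ a, β j k * r j k a / μ a = β j k * t := by
      rw [ht, Finset.mul_sum]; exact Finset.sum_congr rfl fun a _ => mul_div_assoc _ _ _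
    rw [hβt]
    -- The test vector is `M⁻¹ b`: the form `M` takes the value `t` there, its rank-one part `β b
    -- bᴴ` the value `β t²`.
    set y : E := ∑ a, ((((μ a)⁻¹ : ℝ) : ℂ) * inner ℂ (v a) (b j k)) • v a with hy
    have hyv : ∀ a, inner ℂ (v a) y = (((μ a)⁻¹ : ℝ) : ℂ) * inner ℂ (v a) (b j k) := fun a => by
      rw [hy]; exact v.orthonormal.inner_right_fintype _ _
    have hyb : inner ℂ (b j k) y = ((t : ℝ) : ℂ) := by
      rw [hy, inner_sum, ht, Complex.ofReal_sum]
      refine Finset.sum_congr rfl fun a _ => ?_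
      rw [inner_smul_right, mul_assoc, hr]
      dsimp only
      rw [div_eq_inv_mul, Complex.ofReal_mul, ← inner_conj_symm (b j k) (v a), Complex.mul_conj,
        Complex.normSq_eq_norm_sq]
    have h1 : specForm v μ y = t := by
      rw [specForm, ht]
      refine Finset.sum_congr rfl fun a _ => ?_
      rw [hyv, norm_mul, mul_pow, Complex.norm_real, Real.norm_eq_abs, sq_abs]
      change μ a * ((μ a)⁻¹ ^ 2 * r j k a) = _
      by_cases ha : μ a = 0
      · simp [ha]
      · field_simp
    have h2 : β j k * t ^ 2 ≤ t := by
      rw [← h1, hsum y]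
      have h3 : specForm (b j) (β j) y ≤ ∑ j, specForm (b j) (β j) y :=
        Finset.single_le_sum (f := fun j => specForm (b j) (β j) y)
          (fun j _ => specForm_nonneg _ (hβ j) _) (Finset.mem_univ j)
      refine le_trans ?_ h3
      have h4 : β j k * ‖inner ℂ (b j k) y‖ ^ 2 ≤ specForm (b j) (β j) y :=
        Finset.single_le_sum (f := fun k => β j k * ‖inner ℂ (b j k) y‖ ^ 2)
          (fun k _ => mul_nonneg (hβ j k) (sq_nonneg _)) (Finset.mem_univ k)
      rw [hyb, Complex.norm_real, Real.norm_eq_abs, sq_abs] at h4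
      rwa [← hsum y, h1]
    rcases ht0.eq_or_lt with h | h
    · rw [← h]; simp
    · by_contra! hcon
      nlinarith
  -- The weights `β r / μ a` have barycentre `β` on the points `μ a`; summed over `j, k` at fixed
  -- `a` they total one when `μ a ≠ 0`.
  have hjensen : ∀ j k, ∑ a, β j k * r j k a / μ a * f (μ a) ≤ f (β j k) := by
    intro j k
    refine (hf.sum_le_map_sum_of_weights_le_one hf0.ge Finset.univ
      (fun a _ => div_nonneg (mul_nonneg (hβ j k) (hr0 j k a)) (hμ a)) (hp1 j k)
      (fun a _ => hμ a)).trans_eq (congrArg f ?_)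
    refine Eq.trans ?_ ((Finset.mul_sum _ _ _).symm.trans
      ((congrArg (β j k * ·) (hmass j k)).trans (mul_one _)))
    refine Finset.sum_congr rfl fun a _ => ?_
    by_cases ha : μ a = 0
    · rw [ha, hzero j k a ha]; simp
    · rw [div_mul_cancel₀ _ ha]
  refine le_trans (le_of_eq ?_)
    (Finset.sum_le_sum fun j _ => Finset.sum_le_sum fun k _ => hjensen j k)
  rw [Finset.sum_congr rfl fun j _ => Finset.sum_comm, Finset.sum_comm]
  refine Finset.sum_congr rfl fun a _ => ?_
  simp only [← Finset.sum_mul, ← Finset.sum_div, ← hr_form, ← hμ_eq]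
  by_cases ha : μ a = 0
  · rw [ha, hf0]; simp
  · rw [div_self ha, one_mul]

/-- Subadditivity of a concave function of a sum of positive forms, on the span of the
eigenvectors on which the function exceeds a given level. -/
theorem sum_filter_map_le_sum_specForm (v : OrthonormalBasis ι ℂ E) {μ : ι → ℝ}
    (b : J → OrthonormalBasis κ ℂ E) {β : J → κ → ℝ} (hβ : ∀ j a, 0 ≤ β j a)
    (hsum : ∀ x, specForm v μ x = ∑ j, specForm (b j) (β j) x) {f : ℝ → ℝ}
    (hf : ConcaveOn ℝ (Set.Ici 0) f) (hf_nonneg : ∀ t, 0 ≤ t → 0 ≤ f t) {c : ℝ} (hc : f 0 ≤ c) :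
    ∑ a with c < f (μ a), f (μ a) ≤
      ∑ a with c < f (μ a), ∑ j, specForm (b j) (f ∘ β j) (v a) := by
  classical
  set s : Finset ι := Finset.univ.filter fun a => c < f (μ a) with hs
  have hμ_eq : ∀ a, μ a = ∑ j, specForm (b j) (β j) (v a) := fun a => by
    rw [← hsum, specForm_apply_self]
  have hμ : ∀ a, 0 ≤ μ a := fun a => by
    rw [hμ_eq]; exact Finset.sum_nonneg fun j _ => specForm_nonneg _ (hβ j) _
  have hmono := hf.monotoneOn_of_nonneg hf_nonneg
  rcases s.eq_empty_or_nonempty with hse | hsne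
  · rw [hse]; simp
  obtain ⟨a₀, ha₀, hmin⟩ := s.exists_min_image μ hsne
  have ha₀c : c < f (μ a₀) := (Finset.mem_filter.1 ha₀).2
  have hτ : 0 < μ a₀ := by
    refine lt_of_le_of_ne (hμ a₀) fun h => ?_
    rw [← h] at ha₀c
    exact absurd ha₀c (not_lt.2 hc)
  -- The slope of the line from the origin through the graph of `f` at the least selected
  -- eigenvalue, which is positive because `f 0 ≤ c`.
  set α := f (μ a₀) / μ a₀ with hα
  have hα0 : 0 ≤ α := div_nonneg (hf_nonneg _ (hμ a₀)) hτ.le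
  have hchord : ∀ x y, 0 < x → x ≤ y → f y * x ≤ f x * y := by
    intro x y hx hxy
    have hy : 0 < y := hx.trans_le hxy
    have h := hf.2 (Set.mem_Ici.2 le_rfl) (Set.mem_Ici.2 hy.le)
      (show 0 ≤ 1 - x / y by rw [sub_nonneg]; exact (div_le_one hy).2 hxy)
      (show 0 ≤ x / y by positivity) (by ring)
    simp only [smul_eq_mul, mul_zero, zero_add] at h
    rw [div_mul_cancel₀ _ hy.ne'] at h
    have h2 : 0 ≤ (1 - x / y) * f 0 :=
      mul_nonneg (by rw [sub_nonneg]; exact (div_le_one hy).2 hxy) (hf_nonneg 0 le_rfl)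
    have h3 : x / y * f y ≤ f x := by linarith
    calc f y * x = (x / y * f y) * y := by field_simp
      _ ≤ f x * y := mul_le_mul_of_nonneg_right h3 hy.le
  -- As `f t / t` is nonincreasing, this truncation equals `f` on the selected eigenvalues and `α t`
  -- on the others, and it vanishes at `0` as Rotfel'd's inequality requires.
  set g : ℝ → ℝ := fun t => min (f t) (α * t) with hg
  have hg_concave : ConcaveOn ℝ (Set.Ici 0) g := by
    refine hf.inf ⟨convex_Ici 0, fun x _ y _ p q _ _ _ => le_of_eq ?_⟩
    simp only [smul_eq_mul]; ring
  have hg0 : g 0 = 0 := by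
    simp only [hg, mul_zero]
    exact min_eq_right (hf_nonneg 0 le_rfl)
  have hg_mem : ∀ a ∈ s, g (μ a) = f (μ a) := by
    intro a ha
    refine min_eq_left ?_
    have := hchord _ _ hτ (hmin a ha)
    rw [hα, div_mul_eq_mul_div, le_div_iff₀ hτ]
    exact this
  have hg_not_mem : ∀ a ∉ s, g (μ a) = α * μ a := by
    intro a ha
    refine min_eq_right ?_
    have hac : f (μ a) ≤ c := not_lt.1 fun h => ha (Finset.mem_filter.2 ⟨Finset.mem_univ _, h⟩)
    have hle : μ a ≤ μ a₀ := by
      by_contra! h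
      have := hmono (Set.mem_Ici.2 (hμ a₀)) (Set.mem_Ici.2 (hμ a)) h.le
      linarith
    rcases (hμ a).eq_or_lt with h | h
    · rw [← h, mul_zero]; exact hf_nonneg 0 le_rfl
    · have := hchord _ _ h hle
      rw [hα, div_mul_eq_mul_div, div_le_iff₀ hτ]
      exact this
  have hrot := sum_map_le_sum_map_of_specForm_sum v b hβ hsum hg_concave hg0
  have htrace : ∑ j, ∑ k, g (β j k) = ∑ a, ∑ j, specForm (b j) (g ∘ β j) (v a) := by
    rw [Finset.sum_comm (s := Finset.univ (α := ι))]
    exact Finset.sum_congr rfl fun j _ => (sum_specForm_basis (b j) v (g ∘ β j)).symm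
  rw [htrace, ← Finset.sum_add_sum_compl s, ← Finset.sum_add_sum_compl s] at hrot
  rw [Finset.sum_congr rfl hg_mem,
    Finset.sum_congr rfl fun a ha => hg_not_mem a (Finset.mem_compl.1 ha)] at hrot
  have h1 : ∑ a ∈ s, ∑ j, specForm (b j) (g ∘ β j) (v a) ≤
      ∑ a ∈ s, ∑ j, specForm (b j) (f ∘ β j) (v a) :=
    Finset.sum_le_sum fun a _ => Finset.sum_le_sum fun j _ =>
      specForm_mono _ (fun k => min_le_left _ _) _
  -- Off the selected set `g ≤ α t` leaves at most `α ∑ μ a`, the very sum standing on the left of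
  -- `hrot`, so the two cancel.
  have h2 : ∑ a ∈ sᶜ, ∑ j, specForm (b j) (g ∘ β j) (v a) ≤ ∑ a ∈ sᶜ, α * μ a := by
    refine Finset.sum_le_sum fun a _ => ?_
    rw [hμ_eq, Finset.mul_sum]
    refine Finset.sum_le_sum fun j _ => ?_
    rw [← specForm_const_mul]
    exact specForm_mono _ (fun k => min_le_right _ _) _
  linarith

/-- The thresholded traces of `f (∑ j, B i j)`, summed over `i`, are dominated by the thresholded
trace of `∑ i, ∑ j, f (B i j)`. -/
theorem sum_threshold_le_threshold_sum [FiniteDimensional ℂ E]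
    (v : I → OrthonormalBasis ι ℂ E) {μ : I → ι → ℝ}
    (b : I → J → OrthonormalBasis ι ℂ E) {β : I → J → ι → ℝ} (hβ : ∀ i j a, 0 ≤ β i j a)
    (hsum : ∀ i x, specForm (v i) (μ i) x = ∑ j, specForm (b i j) (β i j) x) {f : ℝ → ℝ}
    (hf : ConcaveOn ℝ (Set.Ici 0) f) (hf_nonneg : ∀ t, 0 ≤ t → 0 ≤ f t)
    (d : OrthonormalBasis ι ℂ E) {δ : ι → ℝ}
    (hd : ∀ x, specForm d δ x = ∑ i, ∑ j, specForm (b i j) (f ∘ β i j) x)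
    {c : ℝ} (hc0 : 0 ≤ c) (hc : f 0 ≤ c) :
    ∑ i, ∑ a, max (f (μ i a) - c) 0 ≤ ∑ a, max (δ a - c) 0 := by
  classical
  refine le_trans (Finset.sum_le_sum fun i _ => ?_)
    (sum_sum_specForm_sub_le b (fun i j a => hf_nonneg _ (hβ i j a)) (fun i => (v i).orthonormal)
      (fun i => Finset.univ.filter fun a => c < f (μ i a)) d δ hd hc0)
  have h := sum_filter_map_le_sum_specForm (v i) (b i) (hβ i) (hsum i) hf hf_nonneg hc
  have h1 : ∑ a, max (f (μ i a) - c) 0 = ∑ a with c < f (μ i a), (f (μ i a) - c) := by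
    rw [Finset.sum_filter]
    refine Finset.sum_congr rfl fun a _ => ?_
    split_ifs with h
    · exact max_eq_left (by linarith)
    · exact max_eq_right (by linarith)
  rw [h1, Finset.sum_sub_distrib, Finset.sum_sub_distrib]
  exact sub_le_sub_right h _

end SpecForm

/-! ### Quadratic forms of Hermitian matrices in their eigenbases. -/

section Quadratic

theorem sum_norm_sq_eq_re_dotProduct {ι : Type*} [Fintype ι] (x : ι → ℂ) :
    ∑ a, ‖x a‖ ^ 2 = (star x ⬝ᵥ x).re := by
  rw [dotProduct, Complex.re_sum]
  refine Finset.sum_congr rfl fun a _ => ?_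
  rw [Pi.star_apply, ← Complex.normSq_eq_norm_sq, Complex.star_def,
    ← Complex.normSq_eq_conj_mul_self, Complex.ofReal_re]

variable {ι : Type*} [Fintype ι] [DecidableEq ι]

theorem re_dotProduct_mulVec_unitary_conj (U : Matrix ι ι ℂ) (γ : ι → ℝ) (x : ι → ℂ) :
    (star x ⬝ᵥ (U * realDiagonal γ * Uᴴ) *ᵥ x).re = ∑ a, γ a * ‖(Uᴴ *ᵥ x) a‖ ^ 2 := by
  rw [← Matrix.mulVec_mulVec, ← Matrix.mulVec_mulVec, Matrix.dotProduct_mulVec,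
    ← Matrix.conjTranspose_conjTranspose U, ← Matrix.star_mulVec,
    Matrix.conjTranspose_conjTranspose, dotProduct, Complex.re_sum]
  refine Finset.sum_congr rfl fun a _ => ?_
  rw [realDiagonal, Matrix.mulVec_diagonal, Pi.star_apply, ← Complex.normSq_eq_norm_sq,
    Complex.star_def, mul_left_comm, ← Complex.normSq_eq_conj_mul_self, ← Complex.ofReal_mul,
    Complex.ofReal_re]

theorem sum_norm_sq_unitary_mulVec {U : Matrix ι ι ℂ} (hU : U ∈ Matrix.unitaryGroup ι ℂ)
    (x : ι → ℂ) : ∑ a, ‖(Uᴴ *ᵥ x) a‖ ^ 2 = ∑ a, ‖x a‖ ^ 2 := by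
  have h := re_dotProduct_mulVec_unitary_conj U (fun _ => 1) x
  have h1 : (realDiagonal fun _ : ι => (1 : ℝ)) = 1 := by simp [realDiagonal]
  rw [h1, mul_one, ← Matrix.star_eq_conjTranspose, Matrix.mem_unitaryGroup_iff.1 hU,
    Matrix.one_mulVec] at h
  simp only [one_mul] at h
  rw [← Matrix.star_eq_conjTranspose, ← h, sum_norm_sq_eq_re_dotProduct]

theorem Matrix.IsHermitian.exists_unitary_conj {A : Matrix ι ι ℂ} (hA : A.IsHermitian)
    (f : ℝ → ℝ) : cfc f A = (hA.eigenvectorUnitary : Matrix ι ι ℂ) *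
      realDiagonal (f ∘ hA.eigenvalues) * (hA.eigenvectorUnitary : Matrix ι ι ℂ)ᴴ := by
  rw [hA.cfc_eq, Matrix.IsHermitian.cfc, Unitary.conjStarAlgAut_apply]
  rfl

theorem Matrix.IsHermitian.eq_unitary_conj {A : Matrix ι ι ℂ} (hA : A.IsHermitian) :
    A = (hA.eigenvectorUnitary : Matrix ι ι ℂ) *
      realDiagonal hA.eigenvalues * (hA.eigenvectorUnitary : Matrix ι ι ℂ)ᴴ := by
  conv_lhs => rw [← cfc_id ℝ A (show IsSelfAdjoint A from hA), hA.exists_unitary_conj]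
  rfl

/-- The quadratic form of `f(A)` in the eigenbasis of `A`. -/
theorem Matrix.IsHermitian.specForm_cfc {A : Matrix ι ι ℂ} (hA : A.IsHermitian) (f : ℝ → ℝ)
    (x : EuclideanSpace ℂ ι) :
    specForm hA.eigenvectorBasis (f ∘ hA.eigenvalues) x =
      (star x.ofLp ⬝ᵥ cfc f A *ᵥ x.ofLp).re := by
  rw [hA.exists_unitary_conj, re_dotProduct_mulVec_unitary_conj, specForm]
  refine Finset.sum_congr rfl fun a _ => ?_
  congr 3
  rw [EuclideanSpace.inner_eq_star_dotProduct, dotProduct_comm]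
  simp [Matrix.mulVec, dotProduct, Matrix.IsHermitian.eigenvectorUnitary_apply]

theorem Matrix.IsHermitian.specForm_eigenvalues {A : Matrix ι ι ℂ} (hA : A.IsHermitian)
    (x : EuclideanSpace ℂ ι) :
    specForm hA.eigenvectorBasis hA.eigenvalues x = (star x.ofLp ⬝ᵥ A *ᵥ x.ofLp).re := by
  have h := hA.specForm_cfc id x
  rwa [cfc_id ℝ A (show IsSelfAdjoint A from hA)] at h

end Quadratic

/-! ### Eigenvalues and determinants of compressions. -/

section Interlacing

open scoped ComplexOrder

/-- **Cauchy interlacing**: the ordered eigenvalues of a compression are dominated by those of the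
ambient form. -/
theorem eigenvalue_le_of_compression {E : Type*} [NormedAddCommGroup E] [InnerProductSpace ℂ E]
    {k m : ℕ} (b : OrthonormalBasis (Fin k) ℂ E) {β : Fin k → ℝ} (hβ : Antitone β)
    {γ : Fin m → ℝ} (hγ : Antitone γ) (hγ0 : ∀ i, 0 ≤ γ i) (L : E →ₗ[ℂ] (Fin m → ℂ))
    (hL : ∀ x, ∑ i, ‖L x i‖ ^ 2 ≤ ‖x‖ ^ 2)
    (hle : ∀ x, specForm b β x ≤ ∑ i, γ i * ‖L x i‖ ^ 2) (l : Fin k) :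
    β l ≤ extendZero γ l := by
  -- `S` parametrizes the span of the top `l + 1` eigenvectors; `T` records the first `l`
  -- coordinates of the image under `L`. The dimension count yields `z ≠ 0` with these coordinates
  -- zero, where the smaller form is at least `β l ‖z‖²` and the larger at most `γ l ‖z‖²`.
  let S : (Fin (l + 1) → ℂ) →ₗ[ℂ] E :=
    { toFun := fun c => ∑ a, c a • b (Fin.castLE l.2 a)
      map_add' := fun c d => by simp [add_smul, Finset.sum_add_distrib]
      map_smul' := fun r c => by simp [mul_smul, Finset.smul_sum] }
  let T : (Fin (l + 1) → ℂ) →ₗ[ℂ] (Fin l → ℂ) :=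
    LinearMap.pi fun i => if h : (i : ℕ) < m then (LinearMap.proj ⟨i, h⟩ ∘ₗ L ∘ₗ S) else 0
  have hker : LinearMap.ker T ≠ ⊥ := LinearMap.ker_ne_bot_of_finrank_lt (by simp)
  obtain ⟨c, hcT, hc0⟩ := Submodule.exists_mem_ne_zero_of_ne_bot hker
  set z := S c with hz
  have hzin : ∀ a : Fin k, inner ℂ (b a) z =
      if h : (a : ℕ) < l + 1 then c ⟨a, h⟩ else 0 := by
    intro a
    change inner ℂ (b a) (∑ i, c i • b (Fin.castLE l.2 i)) = _
    simp only [inner_sum, inner_smul_right, OrthonormalBasis.inner_eq_ite]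
    split_ifs with h
    · rw [Finset.sum_eq_single ⟨a, h⟩]
      · simp
      · intro i _ hi
        rw [if_neg, mul_zero]
        intro heq
        exact hi (Fin.ext (congrArg Fin.val heq).symm)
      · simp
    · refine Finset.sum_eq_zero fun i _ => ?_
      rw [if_neg, mul_zero]
      intro heq
      exact h (by rw [heq]; exact i.2)
  have hz0 : 0 < ‖z‖ ^ 2 := by
    have : z ≠ 0 := by
      intro h0
      refine hc0 (funext fun i => ?_)
      have h1 := hzin (Fin.castLE l.2 i)
      rw [h0, inner_zero_right] at h1
      rw [dif_pos (show ((Fin.castLE l.2 i : Fin k) : ℕ) < l + 1 from i.2)] at h1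
      exact h1.symm
    positivity
  have h1 : β l * ‖z‖ ^ 2 ≤ specForm b β z := by
    rw [← b.sum_sq_norm_inner_right z, Finset.mul_sum, specForm]
    refine Finset.sum_le_sum fun a _ => ?_
    by_cases h : (a : ℕ) < l + 1
    · exact mul_le_mul_of_nonneg_right (hβ (Fin.le_def.2 (by omega))) (sq_nonneg _)
    · rw [hzin, dif_neg h]; simp
  have h2 : ∑ i, γ i * ‖L z i‖ ^ 2 ≤ extendZero γ l * ∑ i, ‖L z i‖ ^ 2 := by
    rw [Finset.mul_sum]
    refine Finset.sum_le_sum fun i _ => ?_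
    by_cases h : (i : ℕ) < l
    · have h3 : T c ⟨i, h⟩ = 0 := by rw [LinearMap.mem_ker.1 hcT]; rfl
      have h4 : T c ⟨i, h⟩ = L z i := by
        simp [T, hz]
      rw [← h4, h3]; simp
    · refine mul_le_mul_of_nonneg_right ?_ (sq_nonneg _)
      rw [← extendZero_of_lt γ i.2]
      exact extendZero_antitone hγ0 hγ (not_lt.1 h)
  have h3 := mul_le_mul_of_nonneg_left (hL z) (extendZero_nonneg hγ0 (l : ℕ))
  exact le_of_mul_le_mul_right ((h1.trans (hle z)).trans (h2.trans h3)) hz0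

/-- The determinant of a compression is at most the product of the largest eigenvalues. -/
theorem det_le_of_compression {k m : ℕ} {X : Matrix (Fin k) (Fin k) ℂ} (hX : X.PosSemidef)
    {γ : Fin m → ℝ} (hγ : Antitone γ) (hγ0 : ∀ i, 0 ≤ γ i) (L : (Fin k → ℂ) →ₗ[ℂ] (Fin m → ℂ))
    (hL : ∀ x, ∑ i, ‖L x i‖ ^ 2 ≤ ∑ i, ‖x i‖ ^ 2)
    (hle : ∀ x, (star x ⬝ᵥ X *ᵥ x).re ≤ ∑ i, γ i * ‖L x i‖ ^ 2) :
    ∃ r : ℝ, X.det = r ∧ 0 ≤ r ∧ r ≤ ∏ l ∈ Finset.range k, extendZero γ l := by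
  obtain ⟨e₀, he₀⟩ := exists_equiv_antitone hX.1.eigenvalues
  let e : Fin k ≃ Fin k := (finCongr (Fintype.card_fin k).symm).trans e₀
  have he : Antitone (hX.1.eigenvalues ∘ e) := fun i j hij => he₀ hij
  refine ⟨∏ i, hX.1.eigenvalues i, ?_, Finset.prod_nonneg fun i _ => hX.eigenvalues_nonneg i, ?_⟩
  · rw [hX.1.det_eq_prod_eigenvalues, Complex.ofReal_prod]; rfl
  · rw [← Equiv.prod_comp e, Finset.prod_range]
    refine Finset.prod_le_prod (fun i _ => hX.eigenvalues_nonneg _) fun i _ => ?_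
    refine eigenvalue_le_of_compression (hX.1.eigenvectorBasis.reindex e.symm) he hγ hγ0
      (L ∘ₗ (WithLp.linearEquiv 2 ℂ (Fin k → ℂ)).toLinearMap) ?_ ?_ i
    · intro x
      rw [EuclideanSpace.norm_sq_eq]
      exact hL x.ofLp
    · intro x
      refine le_trans (le_of_eq ?_) (hle x.ofLp)
      rw [← hX.1.specForm_eigenvalues, specForm, specForm, ← Equiv.sum_comp e fun a =>
        hX.1.eigenvalues a * ‖inner ℂ (hX.1.eigenvectorBasis a) x‖ ^ 2]
      simp

end Interlacing

/-! ### Corners of positive block matrices. -/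

section BlockDet

open scoped ComplexOrder

theorem posSemidef_lower_of_fromBlocks {κ ι : Type*} [Fintype κ] [Fintype ι]
    {P : Matrix κ κ ℂ} {Q : Matrix κ ι ℂ} {R : Matrix ι ι ℂ}
    (h : (Matrix.fromBlocks P Q Qᴴ R).PosSemidef) : R.PosSemidef := by
  exact h.submatrix (Sum.inr : ι → κ ⊕ ι)

/-- If a positive block matrix has invertible off-diagonal block, then its corners are definite. -/
theorem posDef_of_fromBlocks {κ : Type*} [Fintype κ] [DecidableEq κ]
    {P Q R : Matrix κ κ ℂ} (h : (Matrix.fromBlocks P Q Qᴴ R).PosSemidef) (hQ : Q.det ≠ 0) :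
    R.PosDef := by
  have hR := posSemidef_lower_of_fromBlocks h
  rw [hR.posDef_iff_det_ne_zero]
  intro hdet
  obtain ⟨x, hx0, hx⟩ := Matrix.exists_mulVec_eq_zero_iff.2 hdet
  -- If `R x = 0`, the positive form vanishes at `(0, x)`, so the whole matrix annihilates this
  -- vector, and with it `Q x = 0`.
  have h1 := (h.dotProduct_mulVec_zero_iff (Sum.elim 0 x)).1 (by
    rw [Matrix.fromBlocks_mulVec]
    simp [hx, dotProduct])
  rw [Matrix.fromBlocks_mulVec] at h1
  have h2 : Q *ᵥ x = 0 := by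
    funext i
    have := congrFun h1 (Sum.inl i)
    simpa using this
  exact hQ (Matrix.exists_mulVec_eq_zero_iff.1 ⟨x, hx0, h2⟩)

/-- The linear map `x ↦ (Uᴴ V x) ∘ e`, giving the coordinates of `V x` in the columns of `U`. -/
noncomputable def columnCoords {κ : Type*} [Fintype κ] {k m : ℕ} (U : Matrix κ κ ℂ)
    (V : Matrix κ (Fin k) ℂ) (e : Fin m → κ) : (Fin k → ℂ) →ₗ[ℂ] (Fin m → ℂ) :=
  (LinearMap.funLeft ℂ ℂ e) ∘ₗ (Uᴴ * V).mulVecLin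

theorem columnCoords_apply {κ : Type*} [Fintype κ] {k m : ℕ} (U : Matrix κ κ ℂ)
    (V : Matrix κ (Fin k) ℂ) (e : Fin m → κ) (x : Fin k → ℂ) (i : Fin m) :
    columnCoords U V e x i = (Uᴴ *ᵥ (V *ᵥ x)) (e i) := by
  simp [columnCoords, LinearMap.funLeft_apply, Matrix.mulVec_mulVec]

theorem sum_norm_sq_isometry {κ : Type*} [Fintype κ] {k : ℕ}
    {V : Matrix κ (Fin k) ℂ} (hV : Vᴴ * V = 1) (x : Fin k → ℂ) :
    ∑ a, ‖(V *ᵥ x) a‖ ^ 2 = ∑ i, ‖x i‖ ^ 2 := by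
  rw [sum_norm_sq_eq_re_dotProduct, sum_norm_sq_eq_re_dotProduct, Matrix.star_mulVec,
    ← Matrix.dotProduct_mulVec, Matrix.mulVec_mulVec, hV, Matrix.one_mulVec]

/-- Determinant of a compression of `U diag(γ) Uᴴ` by an isometry (or of anything smaller). -/
theorem det_le_of_isometry {κ : Type*} [Fintype κ] [DecidableEq κ] {k m : ℕ}
    {X : Matrix (Fin k) (Fin k) ℂ} (hX : X.PosSemidef) {U : Matrix κ κ ℂ}
    (hU : U ∈ Matrix.unitaryGroup κ ℂ) {γ : κ → ℝ} (hγ0 : ∀ a, 0 ≤ γ a) (e : Fin m ≃ κ)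
    (he : Antitone (γ ∘ e)) {V : Matrix κ (Fin k) ℂ} (hV : Vᴴ * V = 1)
    (hle : X ≤ Vᴴ * (U * realDiagonal γ * Uᴴ) * V) :
    ∃ r : ℝ, X.det = r ∧ 0 ≤ r ∧ r ≤ ∏ l ∈ Finset.range k, extendZero (γ ∘ e) l := by
  refine det_le_of_compression hX he (fun i => hγ0 _) (columnCoords U V e) ?_ ?_
  · intro x
    simp only [columnCoords_apply]
    rw [Equiv.sum_comp e fun a => ‖(Uᴴ *ᵥ (V *ᵥ x)) a‖ ^ 2, sum_norm_sq_unitary_mulVec hU,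
      sum_norm_sq_isometry hV]
  · intro x
    simp only [columnCoords_apply, Function.comp_apply]
    rw [Equiv.sum_comp e fun a => γ a * ‖(Uᴴ *ᵥ (V *ᵥ x)) a‖ ^ 2,
      ← re_dotProduct_mulVec_unitary_conj]
    have h := (Matrix.le_iff.1 hle).re_dotProduct_nonneg x
    rw [Matrix.sub_mulVec, dotProduct_sub, map_sub, sub_nonneg] at h
    refine h.trans (le_of_eq ?_)
    rw [Matrix.star_mulVec, ← Matrix.dotProduct_mulVec, Matrix.mulVec_mulVec,
      Matrix.mulVec_mulVec]
    rfl

end BlockDet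

/-! ### Weak log-majorization of singular values. -/

section LogMajorization

open scoped ComplexOrder

variable {κ ι : Type*} [Fintype κ] [Fintype ι] [DecidableEq κ] [DecidableEq ι]

/-- Weak log-majorization of the singular values of the corner of a positive block matrix. -/
theorem prod_eigenvalues_le {A : Matrix ι κ ℂ} {U₁ : Matrix κ κ ℂ} {U₂ : Matrix ι ι ℂ}
    (hU₁ : U₁ ∈ Matrix.unitaryGroup κ ℂ) (hU₂ : U₂ ∈ Matrix.unitaryGroup ι ℂ)
    {γ : κ → ℝ} {ρ : ι → ℝ} (hγ0 : ∀ a, 0 ≤ γ a) (hρ0 : ∀ a, 0 ≤ ρ a)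
    (hM : (Matrix.fromBlocks (U₁ * realDiagonal γ * U₁ᴴ) Aᴴ A
      (U₂ * realDiagonal ρ * U₂ᴴ)).PosSemidef)
    {m₁ m₂ : ℕ} (e₁ : Fin m₁ ≃ κ) (e₂ : Fin m₂ ≃ ι) (he₁ : Antitone (γ ∘ e₁))
    (he₂ : Antitone (ρ ∘ e₂)) {k : ℕ} (j : Fin k ↪ κ)
    (hj : ∀ l, 0 < (Matrix.isHermitian_conjTranspose_mul_self A).eigenvalues (j l)) :
    ∏ l, (Matrix.isHermitian_conjTranspose_mul_self A).eigenvalues (j l) ≤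
      (∏ l ∈ Finset.range k, extendZero (γ ∘ e₁) l) *
        ∏ l ∈ Finset.range k, extendZero (ρ ∘ e₂) l := by
  set hH := Matrix.isHermitian_conjTranspose_mul_self A with hH_def
  set s : Fin k → ℝ := fun l => hH.eigenvalues (j l) with hs
  set W : Matrix κ κ ℂ := hH.eigenvectorUnitary.1 with hW
  have hWW : Wᴴ * W = 1 := Matrix.mem_unitaryGroup_iff'.1 hH.eigenvectorUnitary.2
  set V : Matrix κ (Fin k) ℂ := W.submatrix id j with hV
  have hVW : ∀ M : Matrix κ κ ℂ, Vᴴ * M * V = (Wᴴ * M * W).submatrix j j := by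
    intro M; ext a b; simp [hV, Matrix.mul_apply]
  have hVV : Vᴴ * V = 1 := by
    have := hVW 1
    rw [Matrix.mul_one, Matrix.mul_one, hWW] at this
    rw [this, Matrix.submatrix_one _ j.injective]
  have hVH : Vᴴ * (Aᴴ * A) * V = realDiagonal s := by
    have h1 : Wᴴ * (Aᴴ * A) * W = realDiagonal hH.eigenvalues := by
      conv_lhs => rw [hH.eq_unitary_conj]
      rw [← hW, ← mul_assoc, ← mul_assoc, hWW, one_mul, mul_assoc, hWW, mul_one]
    rw [hVW, h1]
    ext a b
    simp [realDiagonal, Matrix.diagonal_apply, hs]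
  set D : Matrix (Fin k) (Fin k) ℂ := realDiagonal fun l => √(s l) with hD
  set D' : Matrix (Fin k) (Fin k) ℂ := realDiagonal fun l => (√(s l))⁻¹ with hD'
  have hsqrt : ∀ l, 0 < √(s l) := fun l => Real.sqrt_pos.2 (hj l)
  have hDh : Dᴴ = D := by
    rw [hD, realDiagonal, Matrix.diagonal_conjTranspose]; congr 1; funext l; simp
  have hD'h : D'ᴴ = D' := by
    rw [hD', realDiagonal, Matrix.diagonal_conjTranspose]; congr 1; funext l; simp
  have hmul : ∀ x y : Fin k → ℝ, realDiagonal x * realDiagonal y = realDiagonal (x * y) := by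
    intro x y; simp [realDiagonal, Matrix.diagonal_mul_diagonal]
  have hDD' : D' * realDiagonal s = D := by
    rw [hD', hD, hmul]; congr 1; funext l
    have := (hsqrt l).ne'
    simp only [Pi.mul_apply]
    field_simp
    exact (Real.sq_sqrt (hj l).le).symm
  have hDinv : D * D' = 1 := by
    rw [hD, hD', hmul, ← Matrix.diagonal_one, realDiagonal]; congr 1; funext l
    simp [(hsqrt l).ne']
  -- The columns of `V` are right singular vectors and those of `Z` the matching left ones, so
  -- compressing by `V ⊕ Z` turns the off-diagonal blocks into the diagonal `D` of singular values.
  set Z : Matrix ι (Fin k) ℂ := A * V * D' with hZ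
  have hZA : Zᴴ * A * V = D := by
    rw [hZ, Matrix.conjTranspose_mul, Matrix.conjTranspose_mul, hD'h, ← hDD', ← hVH]
    simp only [Matrix.mul_assoc]
  have hZZ : Zᴴ * Z = 1 := by
    rw [← hDinv, ← hZA, hZ]
    simp only [Matrix.mul_assoc]
  have hcomp := hM.conjTranspose_mul_mul_same (Matrix.fromBlocks V 0 0 Z)
  rw [Matrix.fromBlocks_conjTranspose, Matrix.fromBlocks_multiply,
    Matrix.fromBlocks_multiply] at hcomp
  simp only [Matrix.conjTranspose_zero, Matrix.zero_mul, Matrix.mul_zero, add_zero, zero_add]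
    at hcomp
  rw [hZA] at hcomp
  have hAZ : Vᴴ * Aᴴ * Z = D := by
    rw [← hDh, ← hZA, Matrix.conjTranspose_mul, Matrix.conjTranspose_mul,
      Matrix.conjTranspose_conjTranspose, Matrix.mul_assoc]
  rw [hAZ] at hcomp
  set C' := Vᴴ * (U₁ * realDiagonal γ * U₁ᴴ) * V with hC'
  set R' := Zᴴ * (U₂ * realDiagonal ρ * U₂ᴴ) * Z with hR'
  have hcomp' : (Matrix.fromBlocks C' D Dᴴ R').PosSemidef := by rw [hDh]; exact hcomp
  have hdetD : D.det ^ 2 = ((∏ l, s l : ℝ) : ℂ) := by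
    rw [hD, realDiagonal, Matrix.det_diagonal, ← Finset.prod_pow, Complex.ofReal_prod]
    refine Finset.prod_congr rfl fun l _ => ?_
    rw [← Complex.ofReal_pow, Real.sq_sqrt (hj l).le]
  have hdetD0 : D.det ≠ 0 := by
    rw [hD, realDiagonal, Matrix.det_diagonal]
    exact Finset.prod_ne_zero_iff.2 fun l _ => Complex.ofReal_ne_zero.2 (hsqrt l).ne'
  have hR'pd : R'.PosDef := posDef_of_fromBlocks hcomp' hdetD0
  have hR'psd := hR'pd.posSemidef
  let _ : Invertible R' := hR'pd.isUnit.invertible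
  have hschur := (hR'pd.fromBlocks₂₂ C' D).1 hcomp'
  have hXpsd : (D * R'⁻¹ * Dᴴ).PosSemidef := hR'pd.inv.posSemidef.mul_mul_conjTranspose_same D
  obtain ⟨r₁, hr₁, hr₁0, hr₁le⟩ := det_le_of_isometry hXpsd hU₁ hγ0 e₁ he₁ hVV
    (Matrix.le_iff.2 hschur)
  obtain ⟨r₂, hr₂, hr₂0, hr₂le⟩ := det_le_of_isometry hR'psd hU₂ hρ0 e₂ he₂ hZZ le_rfl
  -- The Schur complement gives `D R'⁻¹ Dᴴ ≤ C'`; multiplying its determinant by `det R'` recovers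
  -- `det D ^ 2`, the product of squared singular values.
  have hprod : ∏ l, s l = r₁ * r₂ := by
    have h1 : (D * R'⁻¹ * Dᴴ).det * R'.det = D.det ^ 2 := by
      have h2 : R'⁻¹.det * R'.det = 1 := by
        rw [← Matrix.det_mul, Matrix.nonsing_inv_mul _
          ((Matrix.isUnit_iff_isUnit_det _).1 hR'pd.isUnit), Matrix.det_one]
      rw [Matrix.det_mul, Matrix.det_mul, hDh]
      linear_combination D.det ^ 2 * h2
    rw [hr₁, hr₂, hdetD, ← Complex.ofReal_mul] at h1
    exact (Complex.ofReal_injective h1).symm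
  rw [hprod]
  exact mul_le_mul hr₁le hr₂le hr₂0 (hr₁0.trans hr₁le)

end LogMajorization

theorem sum_range_extendZero_le {m : ℕ} {y : Fin m → ℝ} (hy : ∀ i, 0 ≤ y i) {φ : ℝ → ℝ}
    (hφ : ∀ t, 0 ≤ t → 0 ≤ φ t) (hφ0 : φ 0 = 0) (K : ℕ) :
    ∑ l ∈ Finset.range K, φ (extendZero y l) ≤ ∑ i, φ (y i) := by
  have hnn : ∀ l, 0 ≤ φ (extendZero y l) := fun l => hφ _ (extendZero_nonneg hy l)
  rw [← sum_extendZero φ y, Finset.sum_subset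
    (Finset.range_subset_range.2 (le_max_left m K)) (f := fun l => φ (extendZero y l))]
  · exact Finset.sum_le_sum_of_subset_of_nonneg
      (Finset.range_subset_range.2 (le_max_right m K)) fun l _ _ => hnn l
  · intro l _ hl
    rw [extendZero, dif_neg fun h => hl (Finset.mem_range.2 h), hφ0]

/-! ### From log-majorization to sums of an e-convex function. -/

section Singular

open scoped ComplexOrder

variable {κ ι : Type*} [Fintype κ] [Fintype ι] [DecidableEq κ] [DecidableEq ι]

/-- For the off-diagonal block `A` of a positive block matrix and an e-convex nondecreasing `g`,
the sum of `g` over the singular values of `A` is dominated by the means of the sums of `g` over the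
eigenvalues of the diagonal blocks. -/
theorem sum_map_sqrt_eigenvalues_le {A : Matrix ι κ ℂ} {U₁ : Matrix κ κ ℂ} {U₂ : Matrix ι ι ℂ}
    (hU₁ : U₁ ∈ Matrix.unitaryGroup κ ℂ) (hU₂ : U₂ ∈ Matrix.unitaryGroup ι ℂ)
    {γ : κ → ℝ} {ρ : ι → ℝ} (hγ0 : ∀ a, 0 ≤ γ a) (hρ0 : ∀ a, 0 ≤ ρ a)
    (hM : (Matrix.fromBlocks (U₁ * realDiagonal γ * U₁ᴴ) Aᴴ A
      (U₂ * realDiagonal ρ * U₂ᴴ)).PosSemidef)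
    {g : ℝ → ℝ} (hg_mono : MonotoneOn g (Set.Ici 0)) (hg0 : g 0 = 0) (hg_conv : EConvex g) :
    ∑ a, g (√((Matrix.isHermitian_conjTranspose_mul_self A).eigenvalues a)) ≤
      (∑ a, g (γ a) + ∑ a, g (ρ a)) / 2 := by
  set s := (Matrix.isHermitian_conjTranspose_mul_self A).eigenvalues with hs
  have hg_nonneg : ∀ t, 0 ≤ t → 0 ≤ g t := fun t ht => by
    rw [← hg0]; exact hg_mono (Set.mem_Ici.2 le_rfl) ht ht
  have hs0 : ∀ a, 0 ≤ s a := fun a => Matrix.eigenvalues_conjTranspose_mul_self_nonneg A a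
  obtain ⟨e, he⟩ := exists_equiv_antitone s
  obtain ⟨e₁, he₁⟩ := exists_equiv_antitone γ
  obtain ⟨e₂, he₂⟩ := exists_equiv_antitone ρ
  set S := extendZero (s ∘ e) with hS
  set Γ := extendZero (γ ∘ e₁) with hΓ
  set P := extendZero (ρ ∘ e₂) with hP
  have hS_anti : Antitone S := extendZero_antitone (fun i => hs0 _) he
  have hS0 : ∀ l, 0 ≤ S l := extendZero_nonneg fun i => hs0 _
  have hΓ0 : ∀ l, 0 ≤ Γ l := extendZero_nonneg fun i => hγ0 _
  have hP0 : ∀ l, 0 ≤ P l := extendZero_nonneg fun i => hρ0 _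
  have hex : ∃ l, S l ≤ 0 := ⟨Fintype.card κ, by simp [hS, extendZero]⟩
  classical
  -- `K` counts the nonzero singular values. Below `K` all logarithms are of positive numbers;
  -- beyond it the left terms are `g 0 = 0`.
  set K := Nat.find hex with hK
  have hSpos : ∀ l < K, 0 < S l := fun l hl => not_le.1 (Nat.find_min hex hl)
  have hSzero : ∀ l, K ≤ l → S l = 0 := fun l hl =>
    le_antisymm ((hS_anti hl).trans (Nat.find_spec hex)) (hS0 l)
  have hKm : K ≤ Fintype.card κ := Nat.find_min' hex (by simp [hS, extendZero])
  have hprod : ∀ k ≤ K, ∏ l ∈ Finset.range k, S l ≤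
      (∏ l ∈ Finset.range k, Γ l) * ∏ l ∈ Finset.range k, P l := by
    intro k hk
    have hval : ∀ l : Fin k, S l = s (e (Fin.castLE (hk.trans hKm) l)) := fun l =>
      extendZero_of_lt _ (l.2.trans_le (hk.trans hKm))
    have h := prod_eigenvalues_le hU₁ hU₂ hγ0 hρ0 hM e₁ e₂ he₁ he₂
      ((Fin.castLEEmb (hk.trans hKm)).trans e.toEmbedding)
      (fun l => by
        have := hSpos l (l.2.trans_le hk)
        rw [hval] at this
        exact this)
    refine le_trans (le_of_eq ?_) h
    rw [Finset.prod_range]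
    exact Finset.prod_congr rfl fun l _ => hval l
  have hΓP : 0 < (∏ l ∈ Finset.range K, Γ l) * ∏ l ∈ Finset.range K, P l :=
    (Finset.prod_pos fun l hl => hSpos l (Finset.mem_range.1 hl)).trans_le (hprod K le_rfl)
  have hΓpos : ∀ l < K, 0 < Γ l := fun l hl => lt_of_le_of_ne (hΓ0 l) fun h =>
    hΓP.ne' (by rw [Finset.prod_eq_zero (Finset.mem_range.2 hl) h.symm, zero_mul])
  have hPpos : ∀ l < K, 0 < P l := fun l hl => lt_of_le_of_ne (hP0 l) fun h =>
    hΓP.ne' (by rw [Finset.prod_eq_zero (i := l) (s := Finset.range K) (f := P)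
      (Finset.mem_range.2 hl) h.symm, mul_zero])
  have hG_mono : Monotone fun t => g (Real.exp t) := fun x y hxy =>
    hg_mono (Set.mem_Ici.2 (Real.exp_pos x).le) (Set.mem_Ici.2 (Real.exp_pos y).le)
      (Real.exp_le_exp.2 hxy)
  -- `S` holds squared singular values, hence the half logarithm.
  have hkar := ConvexOn.sum_le_sum_of_weak_majorization hg_conv hG_mono (n := K)
    (x := fun l => Real.log (S l) / 2) (y := fun l => (Real.log (Γ l) + Real.log (P l)) / 2)
    (fun i j hij hj => by
      have := Real.log_le_log (hSpos j hj) (hS_anti hij)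
      linarith)
    (fun k hk => by
      have hne : ∀ {F : ℕ → ℝ}, (∀ l < K, 0 < F l) → ∀ l ∈ Finset.range k, F l ≠ 0 :=
        fun hF l hl => (hF l ((Finset.mem_range.1 hl).trans_le hk)).ne'
      have h := Real.log_le_log (Finset.prod_pos fun l hl =>
        hSpos l ((Finset.mem_range.1 hl).trans_le hk)) (hprod k hk)
      rw [Real.log_mul (Finset.prod_ne_zero_iff.2 (hne hΓpos))
        (Finset.prod_ne_zero_iff.2 (hne hPpos)), Real.log_prod (hne hSpos),
        Real.log_prod (hne hΓpos), Real.log_prod (hne hPpos)] at h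
      rw [← Finset.sum_div, ← Finset.sum_div, Finset.sum_add_distrib]
      linarith)
  have hleft : ∑ a, g (√(s a)) = ∑ l ∈ Finset.range K, g (Real.exp (Real.log (S l) / 2)) := by
    rw [← Equiv.sum_comp e]
    have h1 := sum_extendZero (fun t => g (√t)) (s ∘ e)
    simp only [Function.comp_apply] at h1
    rw [← h1, ← hS]
    rw [← Finset.sum_subset (Finset.range_subset_range.2 hKm) (f := fun l => g (√(S l)))]
    · refine Finset.sum_congr rfl fun l hl => ?_
      rw [Real.exp_half, Real.exp_log (hSpos l (Finset.mem_range.1 hl))]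
    · intro l _ hl
      rw [hSzero l (not_lt.1 fun h => hl (Finset.mem_range.2 h)), Real.sqrt_zero, hg0]
  have hmid : ∀ l ∈ Finset.range K, g (Real.exp ((Real.log (Γ l) + Real.log (P l)) / 2)) ≤
      (g (Γ l) + g (P l)) / 2 := by
    intro l hl
    have h := hg_conv.2 (Set.mem_univ (Real.log (Γ l))) (Set.mem_univ (Real.log (P l)))
      (show (0 : ℝ) ≤ 1 / 2 by norm_num) (show (0 : ℝ) ≤ 1 / 2 by norm_num) (by norm_num)
    simp only [smul_eq_mul] at h
    rw [Real.exp_log (hΓpos l (Finset.mem_range.1 hl)),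
      Real.exp_log (hPpos l (Finset.mem_range.1 hl))] at h
    rw [show (Real.log (Γ l) + Real.log (P l)) / 2 =
      1 / 2 * Real.log (Γ l) + 1 / 2 * Real.log (P l) by ring]
    linarith
  have hsumΓ : ∑ l ∈ Finset.range K, g (Γ l) ≤ ∑ a, g (γ a) := by
    rw [← Equiv.sum_comp e₁ fun a => g (γ a)]
    exact sum_range_extendZero_le (fun i => hγ0 _) hg_nonneg hg0 K
  have hsumP : ∑ l ∈ Finset.range K, g (P l) ≤ ∑ a, g (ρ a) := by
    rw [← Equiv.sum_comp e₂ fun a => g (ρ a)]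
    exact sum_range_extendZero_le (fun i => hρ0 _) hg_nonneg hg0 K
  have h := hkar.trans (Finset.sum_le_sum hmid)
  rw [← Finset.sum_div, Finset.sum_add_distrib] at h
  rw [hleft]
  linarith

end Singular

/-! ### Absolute values, and the positive block matrix of a normal matrix. -/

section MatrixAbs

open scoped ComplexOrder

variable {ι κ : Type*} [Fintype ι] [Fintype κ] [DecidableEq ι]

theorem continuousOn_spectrum (A : Matrix ι ι ℂ) (f : ℝ → ℝ) : ContinuousOn f (spectrum ℝ A) :=
  A.finite_real_spectrum.continuousOn f

theorem matrixAbs_eq_cfc (A : Matrix κ ι ℂ) : matrixAbs A = cfc Real.sqrt (Aᴴ * A) := by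
  have h : (0 : Matrix ι ι ℂ) ≤ Aᴴ * A :=
    Matrix.nonneg_iff_posSemidef.2 (Matrix.posSemidef_conjTranspose_mul_self A)
  rw [matrixAbs, CFC.sqrt_eq_cfc, cfc_nnreal_eq_real _ _ h]
  exact cfc_congr fun t _ => Real.coe_sqrt.trans (by
    rcases le_total 0 t with ht | ht
    · rw [Real.coe_toNNReal t ht]
    · rw [Real.toNNReal_of_nonpos ht, Real.sqrt_eq_zero_of_nonpos ht]; simp)

theorem matrixAbs_posSemidef (A : Matrix κ ι ℂ) : (matrixAbs A).PosSemidef :=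
  Matrix.nonneg_iff_posSemidef.1 (CFC.sqrt_nonneg _)

/-- Passes to the eigenvalues of `Aᴴ * A`, for which log-majorization is stated. Continuity is free
on a finite spectrum. -/
theorem funAbs_eq_cfc (f : ℝ → ℝ) (A : Matrix κ ι ℂ) :
    funAbs f A = cfc (fun t => f (√t)) (Aᴴ * A) := by
  have hA : IsSelfAdjoint (Aᴴ * A) := Matrix.isHermitian_conjTranspose_mul_self A
  have hfin : (Real.sqrt '' spectrum ℝ (Aᴴ * A)).Finite :=
    (Matrix.finite_real_spectrum (A := Aᴴ * A)).image _
  rw [funAbs, matrixAbs_eq_cfc]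
  exact (cfc_comp f Real.sqrt (Aᴴ * A) hA (hfin.continuousOn _) (continuousOn_spectrum _ _)).symm

/-- A normal matrix `A` gives a positive block matrix with diagonal blocks `|A|`. -/
theorem fromBlocks_matrixAbs_posSemidef {A : Matrix ι ι ℂ} (hA : IsStarNormal A) :
    (Matrix.fromBlocks (matrixAbs A) Aᴴ A (matrixAbs A)).PosSemidef := by
  set H := Aᴴ * A with hH
  have hHs : IsSelfAdjoint H := Matrix.isHermitian_conjTranspose_mul_self A
  have hHpsd : H.PosSemidef := Matrix.posSemidef_conjTranspose_mul_self A
  have hAA : A * Aᴴ = H := hA.star_comm_self.eq.symm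
  have hspec : ∀ t ∈ spectrum ℝ H, 0 ≤ t := fun t ht =>
    spectrum_nonneg_of_nonneg (Matrix.nonneg_iff_posSemidef.2 hHpsd) ht
  have hcomm : Commute H A := by
    change H * A = A * H
    rw [hH, ← Matrix.mul_assoc, hAA]
  have hmul : ∀ f g : ℝ → ℝ, cfc f H * cfc g H = cfc (fun t => f t * g t) H := fun f g =>
    (cfc_mul f g H (continuousOn_spectrum _ _) (continuousOn_spectrum _ _)).symm
  have hstar : ∀ f : ℝ → ℝ, (cfc f H)ᴴ = cfc f H := fun f => (cfc_predicate f H : IsSelfAdjoint _)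
  -- `G = |A|^{1/2}`, `K` is its pseudo-inverse (through `0⁻¹ = 0`) and `Q` the projection onto the
  -- kernel. The block matrix will be `X Xᴴ` with `X` the column of `G` and `A K`.
  set G := cfc (fun t : ℝ => √√t) H with hG
  set K := cfc (fun t : ℝ => (√√t)⁻¹) H with hK
  set Q := cfc (fun t : ℝ => if t = 0 then (1 : ℝ) else 0) H with hQ
  have hGG : G * G = matrixAbs A := by
    rw [matrixAbs_eq_cfc, hG, hmul]
    exact cfc_congr fun t _ => Real.mul_self_sqrt (Real.sqrt_nonneg t)
  have hid : cfc (fun t : ℝ => t) H = H := cfc_id' ℝ H hHs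
  have hAQ : A * Q = 0 := by
    rw [← Matrix.conjTranspose_mul_self_mul_eq_zero, ← hH]
    refine (congrArg (· * Q) hid.symm).trans ?_
    rw [hQ, hmul, ← cfc_const_zero ℝ H]
    refine cfc_congr fun t _ => ?_
    by_cases ht : t = 0 <;> simp [ht]
  have hKGQ : K * G + Q = 1 := by
    rw [hK, hG, hQ, hmul, ← cfc_add H _ _ (continuousOn_spectrum _ _) (continuousOn_spectrum _ _),
      ← cfc_const_one ℝ H]
    refine cfc_congr fun t ht => ?_
    rcases (hspec t ht).eq_or_lt with h | h
    · simp [← h]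
    · have : √√t ≠ 0 := (Real.sqrt_pos.2 (Real.sqrt_pos.2 h)).ne'
      simp [this, h.ne']
  have hAKG : A * K * G = A := by
    have := congrArg (A * ·) hKGQ
    simp only [Matrix.mul_add, hAQ, add_zero, Matrix.mul_one] at this
    rw [Matrix.mul_assoc]
    exact this
  -- Normality enters here: `A` commutes with `K`, so the product is `K A Aᴴ K = K H K = H^{1/2}`.
  have hAKKA : A * K * (A * K)ᴴ = matrixAbs A := by
    have hcK : A * K = K * A := (hcomm.cfc_real _).eq.symm
    rw [hcK, Matrix.conjTranspose_mul, ← Matrix.mul_assoc, Matrix.mul_assoc K, hAA, hstar,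
      matrixAbs_eq_cfc]
    refine (congrArg (fun M => K * M * K) hid.symm).trans ?_
    rw [hK, hmul, hmul]
    refine cfc_congr fun t ht => ?_
    rcases (hspec t ht).eq_or_lt with h | h
    · simp [← h]
    · have h1 := Real.sqrt_pos.2 h
      have h2 : √√t ≠ 0 := (Real.sqrt_pos.2 h1).ne'
      have h3 : √√t * √√t = √t := Real.mul_self_sqrt h1.le
      have h4 : √t * √t = t := Real.mul_self_sqrt h.le
      field_simp
      rw [sq, h3, h4]
  have hfac : Matrix.fromBlocks (matrixAbs A) Aᴴ A (matrixAbs A) =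
      Matrix.fromRows G (A * K) * (Matrix.fromRows G (A * K))ᴴ := by
    rw [Matrix.conjTranspose_fromRows_eq_fromCols_conjTranspose, Matrix.fromRows_mul_fromCols,
      hAKKA, hstar, hGG, hAKG]
    congr 1
    have := congrArg Matrix.conjTranspose hAKG
    rw [Matrix.conjTranspose_mul, hstar] at this
    exact this.symm
  rw [hfac]
  exact Matrix.posSemidef_self_mul_conjTranspose _

end MatrixAbs

/-! ### Block-diagonal matrices and the positive matrix around `𝔸`. -/

section BlockMatrix

open scoped ComplexOrder

theorem comp_single_apply {I J ι : Type*} [DecidableEq I] [DecidableEq J] (i : I) (j : J)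
    (X : Matrix ι ι ℂ) (a : I × ι) (b : J × ι) :
    Matrix.comp I J ι ι ℂ (Matrix.single i j X) a b =
      if i = a.1 then if j = b.1 then X a.2 b.2 else 0 else 0 := by
  by_cases hi : i = a.1 <;> by_cases hj : j = b.1 <;> simp [hi, hj]

theorem comp_diagonal_apply {J ι : Type*} [DecidableEq J] (U : J → Matrix ι ι ℂ) (a b : J × ι) :
    Matrix.comp J J ι ι ℂ (Matrix.diagonal U) a b =
      if a.1 = b.1 then U a.1 a.2 b.2 else 0 := by
  by_cases h : a.1 = b.1 <;> simp [h]

theorem comp_diagonal_conjTranspose {J ι : Type*} [DecidableEq J] (U : J → Matrix ι ι ℂ) :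
    (Matrix.comp J J ι ι ℂ (Matrix.diagonal U))ᴴ =
      Matrix.comp J J ι ι ℂ (Matrix.diagonal fun j => (U j)ᴴ) := by
  ext a b
  rw [Matrix.conjTranspose_apply, comp_diagonal_apply, comp_diagonal_apply]
  by_cases h : a.1 = b.1
  · simp [h]
  · simp [h, Ne.symm h]

theorem comp_diagonal_mul {J ι : Type*} [Fintype J] [DecidableEq J] [Fintype ι]
    (U V : J → Matrix ι ι ℂ) :
    Matrix.comp J J ι ι ℂ (Matrix.diagonal U) * Matrix.comp J J ι ι ℂ (Matrix.diagonal V) =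
      Matrix.comp J J ι ι ℂ (Matrix.diagonal fun j => U j * V j) := by
  rw [← Matrix.diagonal_mul_diagonal]
  exact (map_mul (Matrix.compRingEquiv J ι ℂ) _ _).symm

/-- The compression onto the block with index `j`. -/
def blockProj {J : Type*} [DecidableEq J] (ι : Type*) [DecidableEq ι] (j : J) :
    Matrix ι (J × ι) ℂ :=
  Matrix.of fun a b => if j = b.1 then if a = b.2 then 1 else 0 else 0

variable {I J ι : Type*} [DecidableEq I] [DecidableEq J] [Fintype ι] [DecidableEq ι]

theorem blockProj_conj (i : I) (j : J) (X : Matrix ι ι ℂ) :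
    (blockProj ι i)ᴴ * X * blockProj ι j = Matrix.comp I J ι ι ℂ (Matrix.single i j X) := by
  ext a b
  rw [comp_single_apply]
  by_cases hi : i = a.1 <;> by_cases hj : j = b.1 <;>
    simp [blockProj, Matrix.mul_apply, hi, hj]

theorem comp_diagonal_mem_unitaryGroup [Fintype J] {U : J → Matrix ι ι ℂ}
    (hU : ∀ j, U j ∈ Matrix.unitaryGroup ι ℂ) :
    Matrix.comp J J ι ι ℂ (Matrix.diagonal U) ∈ Matrix.unitaryGroup (J × ι) ℂ := by
  rw [Matrix.mem_unitaryGroup_iff, Matrix.star_eq_conjTranspose, comp_diagonal_conjTranspose,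
    comp_diagonal_mul]
  have h : (fun j => U j * (U j)ᴴ) = fun _ => 1 :=
    funext fun j => Matrix.mem_unitaryGroup_iff.1 (hU j)
  rw [h]
  exact (congrArg _ Matrix.diagonal_one).trans Matrix.comp_one

/-- Diagonalizing block by block keeps the eigenvalues indexed by block, so traces split over blocks
without sorting the spectrum of the large matrix. -/
theorem comp_diagonal_eq_unitary_conj [Fintype J] {C : J → Matrix ι ι ℂ}
    (hC : ∀ j, (C j).IsHermitian) :
    Matrix.comp J J ι ι ℂ (Matrix.diagonal C) =
      Matrix.comp J J ι ι ℂ (Matrix.diagonal fun j => (hC j).eigenvectorUnitary.1) *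
        realDiagonal (fun b : J × ι => (hC b.1).eigenvalues b.2) *
        (Matrix.comp J J ι ι ℂ (Matrix.diagonal fun j => (hC j).eigenvectorUnitary.1))ᴴ := by
  have h : realDiagonal (fun b : J × ι => (hC b.1).eigenvalues b.2) =
      Matrix.comp J J ι ι ℂ (Matrix.diagonal fun j => realDiagonal (hC j).eigenvalues) :=
    (Matrix.comp_diagonal_diagonal fun j a => (((hC j).eigenvalues a : ℝ) : ℂ)).symm
  rw [h, comp_diagonal_conjTranspose, comp_diagonal_mul, comp_diagonal_mul]
  congr 2
  funext j
  exact (hC j).eq_unitary_conj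

/-- The positive block matrix built from a block matrix with normal blocks. -/
theorem fromBlocks_comp_posSemidef [Fintype I] [Fintype J] (A : Matrix I J (Matrix ι ι ℂ))
    (hA : ∀ i j, IsStarNormal (A i j)) :
    (Matrix.fromBlocks
      (Matrix.comp J J ι ι ℂ (Matrix.diagonal fun j => ∑ i, matrixAbs (A i j)))
      (Matrix.comp I J ι ι ℂ A)ᴴ (Matrix.comp I J ι ι ℂ A)
      (Matrix.comp I I ι ι ℂ (Matrix.diagonal fun i => ∑ j, matrixAbs (A i j)))).PosSemidef := by
  have h : ∀ i j, (Matrix.fromBlocks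
      (Matrix.comp J J ι ι ℂ (Matrix.single j j (matrixAbs (A i j))))
      (Matrix.comp J I ι ι ℂ (Matrix.single j i (A i j)ᴴ))
      (Matrix.comp I J ι ι ℂ (Matrix.single i j (A i j)))
      (Matrix.comp I I ι ι ℂ (Matrix.single i i (matrixAbs (A i j))))).PosSemidef := by
    intro i j
    have := (fromBlocks_matrixAbs_posSemidef (hA i j)).conjTranspose_mul_mul_same
      (Matrix.fromBlocks (blockProj ι j) 0 0 (blockProj ι i))
    rw [Matrix.fromBlocks_conjTranspose, Matrix.fromBlocks_multiply,
      Matrix.fromBlocks_multiply] at this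
    simpa only [Matrix.conjTranspose_zero, Matrix.zero_mul, Matrix.mul_zero, add_zero, zero_add,
      blockProj_conj] using this
  have hsum := Matrix.posSemidef_sum Finset.univ fun i _ =>
    Matrix.posSemidef_sum Finset.univ fun j _ => h i j
  convert hsum using 1
  ext (⟨a, x⟩ | ⟨a, x⟩) (⟨b, y⟩ | ⟨b, y⟩)
  · simp only [Matrix.fromBlocks_apply₁₁, Matrix.sum_apply, comp_single_apply, comp_diagonal_apply,
      Finset.sum_ite_eq', Finset.mem_univ, if_true]
    by_cases hab : a = b <;> simp [hab]
  · simp only [Matrix.fromBlocks_apply₁₂, Matrix.sum_apply, comp_single_apply,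
      Finset.sum_ite_eq', Finset.mem_univ, if_true]
    simp
  · simp only [Matrix.fromBlocks_apply₂₁, Matrix.sum_apply, comp_single_apply]
    rw [Finset.sum_eq_single a (by intro i _ hi; simp [hi]) (by simp)]
    simp
  · simp only [Matrix.fromBlocks_apply₂₂, Matrix.sum_apply, comp_single_apply, comp_diagonal_apply]
    rw [Finset.sum_eq_single a (by intro i _ hi; simp [hi]) (by simp)]
    by_cases hab : a = b <;> simp [hab]

end BlockMatrix

/-! ### Thresholded traces of block matrices and the final norm inequality. -/

section Assembly

open scoped ComplexOrder

theorem isHermitian_cfc {ι : Type*} [Fintype ι] [DecidableEq ι] (f : ℝ → ℝ) (B : Matrix ι ι ℂ) :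
    (cfc f B).IsHermitian := (cfc_predicate f B : IsSelfAdjoint _)

theorem isHermitian_sum {ι J : Type*} [Fintype J] {M : J → Matrix ι ι ℂ}
    (h : ∀ j, (M j).IsHermitian) : (∑ j, M j).IsHermitian := by
  rw [Matrix.IsHermitian, Matrix.conjTranspose_sum]
  exact Finset.sum_congr rfl fun j _ => h j

theorem re_dotProduct_sum_mulVec {ι J : Type*} [Fintype ι] [Fintype J] (M : J → Matrix ι ι ℂ)
    (x : ι → ℂ) : (star x ⬝ᵥ (∑ j, M j) *ᵥ x).re = ∑ j, (star x ⬝ᵥ M j *ᵥ x).re := by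
  rw [Matrix.sum_mulVec, dotProduct_sum, Complex.re_sum]

theorem Matrix.IsHermitian.sum_eigenvalues_eq_re_trace {ι : Type*} [Fintype ι] [DecidableEq ι]
    {A : Matrix ι ι ℂ} (hA : A.IsHermitian) : ∑ a, hA.eigenvalues a = A.trace.re := by
  rw [hA.trace_eq_sum_eigenvalues, Complex.re_sum]
  rfl

theorem Matrix.IsHermitian.re_trace_cfc {ι : Type*} [Fintype ι] [DecidableEq ι]
    {A : Matrix ι ι ℂ} (hA : A.IsHermitian) (f : ℝ → ℝ) :
    (cfc f A).trace.re = ∑ a, f (hA.eigenvalues a) := by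
  have h : (hA.eigenvectorUnitary : Matrix ι ι ℂ)ᴴ * (hA.eigenvectorUnitary : Matrix ι ι ℂ) = 1 :=
    Matrix.mem_unitaryGroup_iff'.1 hA.eigenvectorUnitary.2
  rw [hA.exists_unitary_conj, Matrix.trace_mul_cycle, h, one_mul, realDiagonal,
    Matrix.trace_diagonal, Complex.re_sum]
  rfl

/-- The thresholded traces of `f (∑ j, B i j)` are dominated by that of `∑ i, ∑ j, f (B i j)`. -/
theorem sum_threshold_eigenvalues_le {I J ι : Type*} [Fintype I] [Fintype J] [Fintype ι]
    [DecidableEq ι] {B : I → J → Matrix ι ι ℂ} (hB : ∀ i j, (B i j).PosSemidef)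
    (hC : ∀ i, (∑ j, B i j).IsHermitian) {f : ℝ → ℝ} (hf : ConcaveOn ℝ (Set.Ici 0) f)
    (hf_nonneg : ∀ t, 0 ≤ t → 0 ≤ f t) {T : Matrix ι ι ℂ} (hT : T.IsHermitian)
    (hTB : T = ∑ i, ∑ j, cfc f (B i j)) {c : ℝ} (hc0 : 0 ≤ c) (hc : f 0 ≤ c) :
    ∑ i, ∑ a, max (f ((hC i).eigenvalues a) - c) 0 ≤ ∑ a, max (hT.eigenvalues a - c) 0 := by
  refine sum_threshold_le_threshold_sum (fun i => (hC i).eigenvectorBasis)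
    (fun i j => (hB i j).1.eigenvectorBasis) (fun i j a => (hB i j).eigenvalues_nonneg a)
    (fun i x => ?_) hf hf_nonneg hT.eigenvectorBasis (fun x => ?_) hc0 hc
  · rw [Matrix.IsHermitian.specForm_eigenvalues, re_dotProduct_sum_mulVec]
    exact Finset.sum_congr rfl fun j _ => ((hB i j).1.specForm_eigenvalues x).symm
  · rw [Matrix.IsHermitian.specForm_eigenvalues]
    conv_lhs => rw [hTB]
    rw [re_dotProduct_sum_mulVec]
    refine Finset.sum_congr rfl fun i _ => ?_
    rw [re_dotProduct_sum_mulVec]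
    exact Finset.sum_congr rfl fun j _ => ((hB i j).1.specForm_cfc f x).symm

/-- The thresholded trace inequality for block matrices with normal blocks, at levels `c ≥ f 0`. -/
theorem sum_threshold_singular_le {I J ι : Type*} [Fintype I] [Fintype J] [Fintype ι]
    [DecidableEq I] [DecidableEq J] [DecidableEq ι] (A : Matrix I J (Matrix ι ι ℂ))
    (hA : ∀ i j, IsStarNormal (A i j)) {f : ℝ → ℝ} (hf : ConcaveOn ℝ (Set.Ici 0) f)
    (hf_nonneg : ∀ t, 0 ≤ t → 0 ≤ f t) (hf_econvex : EConvex f)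
    (hT : (∑ i, ∑ j, funAbs f (A i j)).IsHermitian) {c : ℝ} (hc0 : 0 ≤ c) (hc : f 0 ≤ c) :
    ∑ a, max (f (√((Matrix.isHermitian_conjTranspose_mul_self
      (Matrix.comp I J ι ι ℂ A)).eigenvalues a)) - c) 0 ≤ ∑ a, max (hT.eigenvalues a - c) 0 := by
  have hB : ∀ i j, (matrixAbs (A i j)).PosSemidef := fun i j => matrixAbs_posSemidef _
  have hC : ∀ j, (∑ i, matrixAbs (A i j)).PosSemidef := fun j =>
    Matrix.posSemidef_sum _ fun i _ => hB i j
  have hR : ∀ i, (∑ j, matrixAbs (A i j)).PosSemidef := fun i =>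
    Matrix.posSemidef_sum _ fun j _ => hB i j
  have hM := fromBlocks_comp_posSemidef A hA
  rw [comp_diagonal_eq_unitary_conj fun j => (hC j).1,
    comp_diagonal_eq_unitary_conj fun i => (hR i).1] at hM
  have hmono := hf.monotoneOn_of_nonneg hf_nonneg
  have h := sum_map_sqrt_eigenvalues_le
    (comp_diagonal_mem_unitaryGroup fun j => (hC j).1.eigenvectorUnitary.2)
    (comp_diagonal_mem_unitaryGroup fun i => (hR i).1.eigenvectorUnitary.2)
    (fun b => (hC b.1).eigenvalues_nonneg b.2) (fun b => (hR b.1).eigenvalues_nonneg b.2) hM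
    (g := fun t => max (f t - c) 0)
    (fun x hx y hy hxy => max_le_max (sub_le_sub_right (hmono hx hy hxy) c) le_rfl)
    (max_eq_right (sub_nonpos.2 hc))
    ((hf_econvex.add_const (-c)).sup (convexOn_const 0 convex_univ))
  -- Row sums and column sums are bounded by the same thresholded trace, hence so is their mean.
  have h1 := sum_threshold_eigenvalues_le hB (fun i => (hR i).1) hf hf_nonneg hT rfl hc0 hc
  have h2 := sum_threshold_eigenvalues_le (fun j i => hB i j) (fun j => (hC j).1) hf hf_nonneg hT
    Finset.sum_comm hc0 hc
  rw [← Fintype.sum_prod_type fun b : I × ι => max (f ((hR b.1).1.eigenvalues b.2) - c) 0] at h1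
  rw [← Fintype.sum_prod_type fun b : J × ι => max (f ((hC b.1).1.eigenvalues b.2) - c) 0] at h2
  linarith

theorem isHermitian_sum_funAbs {I J ι : Type*} [Fintype I] [Fintype J] [Fintype ι]
    [DecidableEq ι] (A : Matrix I J (Matrix ι ι ℂ)) (f : ℝ → ℝ) :
    (∑ i, ∑ j, funAbs f (A i j)).IsHermitian :=
  isHermitian_sum fun _ => isHermitian_sum fun _ => isHermitian_cfc _ _

theorem posSemidef_sum_funAbs {I J ι : Type*} [Fintype I] [Fintype J] [Fintype ι]
    [DecidableEq ι] (A : Matrix I J (Matrix ι ι ℂ)) {f : ℝ → ℝ} (hf : ∀ t, 0 ≤ t → 0 ≤ f t) :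
    (∑ i, ∑ j, funAbs f (A i j)).PosSemidef :=
  Matrix.posSemidef_sum _ fun i _ => Matrix.posSemidef_sum _ fun j _ =>
    Matrix.nonneg_iff_posSemidef.1 (cfc_nonneg fun t ht => hf t
      (spectrum_nonneg_of_nonneg
        (Matrix.nonneg_iff_posSemidef.2 (matrixAbs_posSemidef (A i j))) ht))

theorem sum_eigenvalues_sum_funAbs {I J ι : Type*} [Fintype I] [Fintype J] [Fintype ι]
    [DecidableEq ι] (A : Matrix I J (Matrix ι ι ℂ)) (f : ℝ → ℝ) :
    ∑ a, (isHermitian_sum_funAbs A f).eigenvalues a =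
      ∑ i, ∑ j, ∑ a, f ((matrixAbs_posSemidef (A i j)).1.eigenvalues a) := by
  rw [Matrix.IsHermitian.sum_eigenvalues_eq_re_trace, Matrix.trace_sum, Complex.re_sum]
  refine Finset.sum_congr rfl fun i _ => ?_
  rw [Matrix.trace_sum, Complex.re_sum]
  exact Finset.sum_congr rfl fun j _ => Matrix.IsHermitian.re_trace_cfc _ f

/-- The thresholded trace inequality for block matrices with normal blocks. -/
theorem sum_threshold_singular_le_of_nonneg {I J ι : Type*} [Fintype I] [Fintype J] [Fintype ι]
    [Nonempty I] [Nonempty J] [DecidableEq I] [DecidableEq J] [DecidableEq ι]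
    (A : Matrix I J (Matrix ι ι ℂ)) (hA : ∀ i j, IsStarNormal (A i j)) {f : ℝ → ℝ}
    (hf : ConcaveOn ℝ (Set.Ici 0) f) (hf_nonneg : ∀ t, 0 ≤ t → 0 ≤ f t) (hf_econvex : EConvex f)
    {c : ℝ} (hc0 : 0 ≤ c) :
    ∑ a, max (f (√((Matrix.isHermitian_conjTranspose_mul_self
      (Matrix.comp I J ι ι ℂ A)).eigenvalues a)) - c) 0 ≤
      ∑ a, max ((isHermitian_sum_funAbs A f).eigenvalues a - c) 0 := by
  rcases le_total (f 0) c with hc | hc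
  · exact sum_threshold_singular_le A hA hf hf_nonneg hf_econvex _ hc0 hc
  set s := (Matrix.isHermitian_conjTranspose_mul_self (Matrix.comp I J ι ι ℂ A)).eigenvalues
  have hmono := hf.monotoneOn_of_nonneg hf_nonneg
  have hf0 : ∀ t, 0 ≤ t → f 0 ≤ f t := fun t ht => hmono (Set.mem_Ici.2 le_rfl) ht ht
  -- For `c ≤ f 0` no term on the left is truncated, so plain traces suffice; they come from `f - f
  -- 0` at level `0`.
  have hT'psd := posSemidef_sum_funAbs A (f := fun t => f t - f 0)
    fun t ht => sub_nonneg.2 (hf0 t ht)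
  have h := sum_threshold_singular_le A hA (f := fun t => f t - f 0)
    (hf.add_const (-f 0)) (fun t ht => sub_nonneg.2 (hf0 t ht)) (hf_econvex.add_const (-f 0))
    (isHermitian_sum_funAbs A fun t => f t - f 0) le_rfl (sub_self _).le
  have hleft : ∑ a, max (f (√(s a)) - f 0 - 0) 0 = ∑ a, (f (√(s a)) - f 0) :=
    Finset.sum_congr rfl fun a _ => by
      rw [sub_zero, max_eq_left (sub_nonneg.2 (hf0 _ (Real.sqrt_nonneg _)))]
  have hright : ∑ a, max ((isHermitian_sum_funAbs A fun t => f t - f 0).eigenvalues a - 0) 0 =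
      ∑ a, (isHermitian_sum_funAbs A fun t => f t - f 0).eigenvalues a :=
    Finset.sum_congr rfl fun a _ => by
      rw [sub_zero, max_eq_left (hT'psd.eigenvalues_nonneg a)]
  have hgoal : ∑ a, max (f (√(s a)) - c) 0 = ∑ a, (f (√(s a)) - c) :=
    Finset.sum_congr rfl fun a _ =>
      max_eq_left (sub_nonneg.2 (hc.trans (hf0 _ (Real.sqrt_nonneg _))))
  have hge : ∑ a, ((isHermitian_sum_funAbs A f).eigenvalues a - c) ≤
      ∑ a, max ((isHermitian_sum_funAbs A f).eigenvalues a - c) 0 :=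
    Finset.sum_le_sum fun a _ => le_max_left _ _
  rw [hleft, hright, sum_eigenvalues_sum_funAbs] at h
  rw [hgoal]
  refine le_trans ?_ hge
  simp only [Finset.sum_sub_distrib, sum_eigenvalues_sum_funAbs, Finset.sum_const,
    Finset.card_univ, Fintype.card_prod, nsmul_eq_mul, Nat.cast_mul] at h ⊢
  have hp : (1 : ℝ) ≤ Fintype.card I := by exact_mod_cast Fintype.card_pos
  have hq : (1 : ℝ) ≤ Fintype.card J := by exact_mod_cast Fintype.card_pos
  have hn : (0 : ℝ) ≤ Fintype.card ι := Nat.cast_nonneg _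
  -- With `p`, `q`, `n` the cardinalities of `I`, `J`, `ι`, the slack is `(p - 1) q n f(0) + (q - 1)
  -- n c`; this uses that `I` and `J` are nonempty.
  have h1 : 0 ≤ (Fintype.card I - 1 : ℝ) * (Fintype.card J * Fintype.card ι * f 0) := by
    have := hf_nonneg 0 le_rfl
    have h2 := sub_nonneg.2 hp
    positivity
  have h2 : 0 ≤ (Fintype.card J - 1 : ℝ) * (Fintype.card ι * c) :=
    mul_nonneg (sub_nonneg.2 hq) (mul_nonneg hn hc0)
  nlinarith

/-- Repeating the eigenvector unitary in every block makes the conjugating matrix unitary at full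
size; the zero blocks are unaffected. -/
theorem zeroPad_eq_unitary_conj {n : ℕ} (q : ℕ) [NeZero q] {S : Matrix (Fin n) (Fin n) ℂ}
    (hS : S.IsHermitian) :
    zeroPad q S =
      Matrix.comp (Fin q) (Fin q) (Fin n) (Fin n) ℂ
        (Matrix.diagonal fun _ => hS.eigenvectorUnitary.1) *
      realDiagonal (fun b : Fin q × Fin n => if b.1 = 0 then hS.eigenvalues b.2 else 0) *
      (Matrix.comp (Fin q) (Fin q) (Fin n) (Fin n) ℂ
        (Matrix.diagonal fun _ => hS.eigenvectorUnitary.1))ᴴ := by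
  have h1 : zeroPad q S = Matrix.comp (Fin q) (Fin q) (Fin n) (Fin n) ℂ
      (Matrix.diagonal fun j => if j = 0 then S else 0) := by
    ext a b
    rw [zeroPad, comp_single_apply, comp_diagonal_apply]
    by_cases ha : a.1 = 0 <;> by_cases hab : a.1 = b.1 <;> simp_all [eq_comm]
  have h2 : realDiagonal (fun b : Fin q × Fin n => if b.1 = 0 then hS.eigenvalues b.2 else 0) =
      Matrix.comp (Fin q) (Fin q) (Fin n) (Fin n) ℂ
        (Matrix.diagonal fun j => if j = 0 then realDiagonal hS.eigenvalues else 0) := by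
    ext a b
    rw [comp_diagonal_apply, realDiagonal, Matrix.diagonal_apply]
    by_cases ha : a.1 = 0 <;> by_cases hab : a.1 = b.1 <;>
      simp_all [realDiagonal, Matrix.diagonal_apply, Prod.ext_iff]
  rw [h1, h2, comp_diagonal_conjTranspose, comp_diagonal_mul, comp_diagonal_mul]
  congr 2
  funext j
  split_ifs
  · exact hS.eq_unitary_conj
  · simp

end Assembly

theorem theorem2p1 {n p q : ℕ} [NeZero p] [NeZero q]
    (A : Matrix (Fin p) (Fin q) (Matrix (Fin n) (Fin n) ℂ))
    (hA : ∀ i j, IsStarNormal (A i j))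
    (f : ℝ → ℝ) (hf_nonneg : ∀ t, 0 ≤ t → 0 ≤ f t)
    (hf_concave : ConcaveOn ℝ (Set.Ici 0) f) (hf_econvex : EConvex f)
    (N : SymmetricNorm (Fin q × Fin n)) :
    N.toSeminorm (funAbs f (Matrix.comp (Fin p) (Fin q) (Fin n) (Fin n) ℂ A)) ≤
      N.toSeminorm (zeroPad q (∑ i, ∑ j, funAbs f (A i j))) := by
  have hS := isHermitian_sum_funAbs A f
  have hU := comp_diagonal_mem_unitaryGroup (J := Fin q) fun _ => hS.eigenvectorUnitary.2
  have hright : N.toSeminorm (zeroPad q (∑ i, ∑ j, funAbs f (A i j))) =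
      N.toSeminorm (realDiagonal
        fun b : Fin q × Fin n => if b.1 = 0 then hS.eigenvalues b.2 else 0) := by
    rw [zeroPad_eq_unitary_conj q hS]
    exact N.unitarily_invariant _ hU _ (Unitary.star_mem hU) _
  rw [hright, funAbs_eq_cfc,
    N.cfc_eq_realDiagonal (Matrix.isHermitian_conjTranspose_mul_self _)]
  refine N.realDiagonal_le (fun a => hf_nonneg _ (Real.sqrt_nonneg _)) (fun b => ?_)
    fun c hc0 => ?_
  · split_ifs
    · exact (posSemidef_sum_funAbs A hf_nonneg).eigenvalues_nonneg _
    · exact le_rfl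
  · refine (sum_threshold_singular_le_of_nonneg A hA hf_concave hf_nonneg hf_econvex hc0).trans_eq ?_
    -- The padding zeros contribute `max (0 - c) 0 = 0` because `c ≥ 0`.
    rw [Fintype.sum_prod_type, Finset.sum_eq_single (0 : Fin q)]
    · simp
    · intro j _ hj
      simp [hj, hc0]
    · simp
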